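/- Let $p$ be a prime of the form $p = 2^s r + 1$, where $r$ is an odd prime such that $2$ is a primitive root modulo $r$ and $r \ge \sqrt p + 1$. Let $m > 1$ be an integer, $\omega$ a primitive element of $\mathbb F_{p^m}$, $N = p^m - 1$, $\nu = (p^m-1)/(p-1)$, $g = \omega^{\nu} \in \mathbb F_p$, and let $D_j = \{ g^{j+2i} : 0 \le i < (p-1)/2\}$ for $j = 0, 1$ (so $D_0$ and $D_1$ are the sets of nonzero quadratic residues and of quadratic non-residues modulo $p$). For $A \in \mathbb F_p$ define $\rho_A : \mathbb F_p \to \mathbb F_2$ by $\rho_A(x) = 0$ if $x + A = 0$ and $\rho_A(x) = k$ if $x + A \in D_k$, $k \in \{0,1\}$. Let $T = (T_n)_{n \ge 0}$ be the binary sequence $T_n = \rho_A(\mathrm{Tr}_{\mathbb F_{p^m}/\mathbb F_p}(\omega^n))$ and let $\overline T_n = T_n + 1$ be its complement. For $e \in \{0, 1, \dots, N-1\}$ let $S^e = (S^e_n)_{n \ge 0}$ be the interleaved sequence of $T$ and the left shift of $\overline T$ by $e$, that is, $S^e_{2j} = T_j$ and $S^e_{2j+1} = \overline T_{j+e}$ for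 $j \ge 0$. For a periodic sequence $S$ over $\mathbb F_2$, the linear complexity $L(S)$ is the length $L$ of the shortest linear recurrence $S_{n+L} = a_{L-1}S_{n+L-1} + \dots + a_0 S_n$ $(n \ge 0)$ satisfied by $S$, and the minimal polynomial of $S$ is $m_S(x) = x^L - a_{L-1}x^{L-1} - \dots - a_0 \in \mathbb F_2[x]$. For integers $a$ and $n \geq 1$ let $a \ \underline{\mathrm{mod}}\ n$ denote the integer $u \in \{1, \dots, n\}$ with $u \equiv a \pmod n$, and let $\nu_2(N)$ be the exponent of the largest power of $2$ dividing $N$. Put $$G(N,e) = \gcd\bigl(-2e+1 \ \underline{\mathrm{mod}}\ N/2^{\nu_2(N)},\ N/2^{\nu_2(N)}\bigr),$$ $$H_0(\nu,e) = \gcd(-2e+1 \ \underline{\mathrm{mod}}\ \nu,\ \nu), \qquad H_1(N,e) = \gcd(-2e+1 \ \underline{\mathrm{mod}}\ N/2,\ N/2).$$ Then the following hold. 1. If either $A = 1$ and $s = 1$, or $\left(\frac{A}{p}\right) = -1$ and $s \ge 2$, then $$m_{S^e}(x) = \frac{x^{2N}+1}{x^{G(N,e)}+1}, \qquad L(S^e)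 = 2N - G(N,e) = 2L(T) - G(N,e).$$ 2. If $\left(\frac{A}{p}\right) = -1$, $m$ is odd and $p \equiv 7 \pmod 8$, then $$m_{S^e}(x) = \frac{(x^{2N}+1)(x^2+1)(x^{H_0(\nu,e)}+1)}{(x^{4\nu}+1)(x^{H_1(N,e)}+1)},$$ $$L(S^e) = 2N + 2 - 4\nu + H_0(\nu,e) - H_1(N,e) = 2L(T) + H_0(\nu,e) - H_1(N,e).$$ In both cases the quotient of polynomials over $\mathbb F_2$ is exact. -/

import Mathlib

open Polynomial

noncomputable section

namespace NTU

/-! ### Sequences, linear complexity, minimal polynomials -/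

/-- The linear complexity of a sequence: the length of a shortest (homogeneous) linear recurrence
`S (n + L) = a_{L-1} S (n + L - 1) + ⋯ + a_0 S n` (for all `n ≥ 0`) that it satisfies. -/
def linearComplexity {K : Type*} [Field K] (S : ℕ → K) : ℕ :=
  sInf {L : ℕ | ∃ E : LinearRecurrence K, E.order = L ∧ E.IsSolution S}

/-- `f` is the minimal polynomial `x ^ L - a_{L-1} x ^ (L - 1) - ⋯ - a_0` of `S`, that is, the
characteristic polynomial of a linear recurrence of shortest length satisfied by `S`. -/
def IsMinimalPolynomial {K : Type*} [Field K] (S : ℕ → K) (f : K[X]) : Prop :=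
  ∃ E : LinearRecurrence K, E.IsSolution S ∧ E.order = linearComplexity S ∧ f = E.charPoly

/-- The left shift `L ^ e (S)`. -/
def leftShift {K : Type*} (e : ℕ) (S : ℕ → K) : ℕ → K := fun n => S (n + e)

/-- The interleaved sequence of a family of `k` sequences: its term of index `j * k + i`
(with `0 ≤ i < k`) is the `j`-th term of the `i`-th sequence. -/
def interleave {K : Type*} {k : ℕ} [NeZero k] (S : Fin k → ℕ → K) : ℕ → K :=
  fun n => S (Fin.ofNat k n) (n / k)

/-! ### Generalized binary NTU sequences -/

/-- The cyclotomic class `D_j = {g ^ j * g ^ (i * d) | 0 ≤ i < (p - 1) / d}` of order `d`. -/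
def cyclotomicClass (p d : ℕ) (g : ZMod p) (j : ℕ) : Set (ZMod p) :=
  {x | ∃ i : ℕ, i < (p - 1) / d ∧ x = g ^ j * g ^ (i * d)}

open Classical in
/-- The map `ρ_A : 𝔽_p → 𝔽_2`: it is `0` if `x + A = 0`, and `k` if `x + A ∈ D_k`, where `D_0`
and `D_1` are the cyclotomic classes of order `2`. -/
def rho (p : ℕ) (g A : ZMod p) (x : ZMod p) : ZMod 2 :=
  if x + A ∈ cyclotomicClass p 2 g 1 then 1 else 0

/-- The m-sequence `R_n = Tr (ω ^ n)`. -/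
def mSeq (p : ℕ) [Fact p.Prime] {F : Type*} [Field F] [Algebra (ZMod p) F] (ω : F) : ℕ → ZMod p :=
  fun n => Algebra.trace (ZMod p) F (ω ^ n)

/-- The binary generalized NTU sequence `T_n = ρ_A (R_n)`. -/
def ntuSeq (p : ℕ) [Fact p.Prime] {F : Type*} [Field F] [Algebra (ZMod p) F] (ω : F)
    (g A : ZMod p) : ℕ → ZMod 2 :=
  fun n => rho p g A (mSeq p ω n)

/-- The complement of a binary sequence. -/
def complement (T : ℕ → ZMod 2) : ℕ → ZMod 2 := fun n => T n - 1

/-- The interleaved sequence `S ^ e` of `T` and `L ^ e` of the complement of `T`. -/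
def interleavedNTU (p : ℕ) [Fact p.Prime] {F : Type*} [Field F] [Algebra (ZMod p) F] (ω : F)
    (g A : ZMod p) (e : ℕ) : ℕ → ZMod 2 :=
  interleave ![ntuSeq p ω g A, leftShift e (complement (ntuSeq p ω g A))]

/-! ### The integers `G (N, e)`, `H_0 (ν, e)`, `H_1 (N, e)` -/

/-- The integer `u ∈ {1, …, n}` with `u ≡ a` modulo `n` (for `n ≥ 1`). -/
def umod (a : ℤ) (n : ℕ) : ℕ := ((a - 1) % (n : ℤ) + 1).toNat

/-- `gcd (-2 e + 1 mod M, M)` for `M` the odd part of `N`. -/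
def gcdG (N e : ℕ) : ℕ :=
  Nat.gcd (umod (-2 * (e : ℤ) + 1) (N / 2 ^ padicValNat 2 N)) (N / 2 ^ padicValNat 2 N)

/-- `gcd (-2 e + 1 mod ν, ν)`. -/
def gcdH0 (ν e : ℕ) : ℕ := Nat.gcd (umod (-2 * (e : ℤ) + 1) ν) ν

/-- `gcd (-2 e + 1 mod N / 2, N / 2)`. -/
def gcdH1 (N e : ℕ) : ℕ := Nat.gcd (umod (-2 * (e : ℤ) + 1) (N / 2)) (N / 2)

end NTU

end

/-! Sequences over 𝔽₂ form an 𝔽₂[X]-module with X acting as the shift. Those of period n > 0 are the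
multiples of `impulse`, whose annihilator is X^n - 1, so P · impulse has minimal polynomial (X^n -
1) / gcd(P, X^n - 1). If P generates T with period N, then S^e is generated, with period 2N, by (X +
X^(2e)) P² + ((X^N - 1)/(X - 1))² (`interleave_complement_eq`). Up to a factor X, X + X^(2e) is X^k
- 1 with k = |2e - 1| odd, hence separable. It remains to locate the zeros of P among the N-th roots
of unity.

At β = α⁻¹ the value of P is α Σ T_j α^j, a sum over F against the character χ with χ(ω) = α. Sorted
by trace, it becomes a sum over 𝔽_p with γ = α^ν times Σ_{Tr z = 1} χ(z) (`sum_ntuSeq_mul_pow`). The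
second factor is nonzero, since otherwise a Gauss sum would vanish. In the first, γ^r = 1 because
the characteristic is 2. If γ ≠ 1, irreducibility of the r-th cyclotomic polynomial turns vanishing
into equality of quadratic characters of differences of 2^s-th powers; a clique bound then gives r²
≤ p, a contradiction (`sum_nonres_mul_pow_ne_zero`). If γ = 1, the factor is (p - 1)/2 - `nonres A`
modulo 2.

In case 1 this parity is 1 and P has no zero. In case 2 it is 0 and P vanishes exactly at the ν-th
roots of unity; the derivative of P shows that 1 is a simple zero and the others are multiple
(`sum_mul_ntuSeq_mul_pow`). The gcd with X^(2N) - 1 then follows root by root. -/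

namespace NTU

/-! ### Periodic sequences as a module over polynomials in the shift -/

section Sequences

variable {K : Type*} [Field K]

/-- The shift operator on sequences, as a linear map. -/
noncomputable def shift (K : Type*) [Field K] : (ℕ → K) →ₗ[K] (ℕ → K) where
  toFun S := fun n => S (n + 1)
  map_add' _ _ := rfl
  map_smul' _ _ := rfl

lemma shift_pow_apply (i : ℕ) (S : ℕ → K) (t : ℕ) : (shift K ^ i) S t = S (t + i) := by
  induction i generalizing t with
  | zero => simp
  | succ i ih =>
    rw [pow_succ', Module.End.mul_apply]
    change (shift K ^ i) S (t + 1) = _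
    rw [ih]
    congr 1
    omega

lemma aeval_shift_apply (f : K[X]) (S : ℕ → K) (t : ℕ) :
    aeval (shift K) f S t = f.sum fun i a => a * S (t + i) := by
  rw [aeval_eq_sum_range, LinearMap.sum_apply, Finset.sum_apply,
    Polynomial.sum_over_range _ (by simp)]
  simp [shift_pow_apply]

lemma isSolution_iff_aeval_charPoly (E : LinearRecurrence K) (S : ℕ → K) :
    E.IsSolution S ↔ aeval (shift K) E.charPoly S = 0 := by
  rw [LinearRecurrence.IsSolution, funext_iff]
  refine forall_congr' fun n => ?_
  rw [LinearRecurrence.charPoly]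
  simp only [map_sub, map_sum, LinearMap.sub_apply, LinearMap.sum_apply, Pi.sub_apply,
    Finset.sum_apply, aeval_monomial, Module.End.mul_apply, Module.algebraMap_end_apply,
    Pi.smul_apply, shift_pow_apply, smul_eq_mul, one_mul, Pi.zero_apply, sub_eq_zero]

/-- Every monic polynomial is the characteristic polynomial of a linear recurrence. -/
lemma exists_charPoly_eq {f : K[X]} (hf : f.Monic) :
    ∃ E : LinearRecurrence K, E.charPoly = f ∧ E.order = f.natDegree := by
  refine ⟨⟨f.natDegree, fun i => -f.coeff i⟩, ?_, rfl⟩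
  rw [LinearRecurrence.charPoly]
  conv_rhs => rw [f.as_sum_range, Finset.sum_range_succ, hf.coeff_natDegree]
  simp [Finset.sum_range, sub_eq_add_neg, add_comm]

/-- A monic generator of the annihilator of a sequence is its only minimal polynomial. -/
lemma minimalPolynomial_of_annihilator {S : ℕ → K} {Q : K[X]} (hQ : Q.Monic)
    (h : ∀ f : K[X], aeval (shift K) f S = 0 ↔ Q ∣ f) :
    linearComplexity S = Q.natDegree ∧ ∀ f, IsMinimalPolynomial S f ↔ f = Q := by
  obtain ⟨E₀, hE₀, hE₀'⟩ := exists_charPoly_eq hQ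
  have hS₀ : E₀.IsSolution S := by
    rw [isSolution_iff_aeval_charPoly, hE₀, h]
  have hdeg : ∀ E : LinearRecurrence K, E.charPoly.natDegree = E.order := fun E =>
    natDegree_eq_of_degree_eq_some E.charPoly_degree_eq_order
  have hL : linearComplexity S = Q.natDegree := by
    refine le_antisymm (Nat.sInf_le ⟨E₀, hE₀', hS₀⟩) ?_
    refine le_csInf ⟨_, E₀, rfl, hS₀⟩ ?_
    rintro L ⟨E, rfl, hE⟩
    rw [isSolution_iff_aeval_charPoly, h] at hE
    rw [← hdeg]
    exact natDegree_le_of_dvd hE E.charPoly_monic.ne_zero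
  refine ⟨hL, fun f => ⟨?_, ?_⟩⟩
  · rintro ⟨E, hE, hord, rfl⟩
    rw [isSolution_iff_aeval_charPoly, h] at hE
    refine (eq_of_monic_of_dvd_of_natDegree_le hQ E.charPoly_monic hE ?_)
    rw [hdeg, hord, hL]
  · rintro rfl
    exact ⟨E₀, hS₀, hE₀'.trans hL.symm, hE₀.symm⟩

/-- The `n`-periodic sequence `0, …, 0, 1, 0, …, 0, 1, …`. -/
def impulse (K : Type*) [Field K] (n : ℕ) : ℕ → K := fun t => if n ∣ t + 1 then 1 else 0

lemma aeval_shift_impulse_eq_zero_of_dvd {n : ℕ} {f : K[X]} (hf : (X ^ n - 1 : K[X]) ∣ f) :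
    aeval (shift K) f (impulse K n) = 0 := by
  obtain ⟨q, rfl⟩ := hf
  rw [mul_comm, map_mul, Module.End.mul_apply]
  have : aeval (shift K) (X ^ n - 1 : K[X]) (impulse K n) = 0 := by
    ext t
    simp only [map_sub, map_pow, aeval_X, map_one, LinearMap.sub_apply, Module.End.one_apply,
      Pi.sub_apply, shift_pow_apply, impulse, Pi.zero_apply]
    simp [show t + n + 1 = t + 1 + n by ring]
  rw [this, map_zero]

/-- The sequence with generating polynomial `∑_{j<n} c_j X ^ (n - 1 - j)`. -/
lemma aeval_shift_impulse_sum {n : ℕ} (c : ℕ → K) {t : ℕ} (ht : t < n) :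
    aeval (shift K) (∑ j ∈ Finset.range n, C (c j) * X ^ (n - 1 - j)) (impulse K n) t = c t := by
  simp only [map_sum, map_mul, aeval_C, map_pow, aeval_X, LinearMap.sum_apply,
    Module.End.mul_apply, Finset.sum_apply, Module.algebraMap_end_apply, Pi.smul_apply,
    shift_pow_apply, smul_eq_mul, impulse]
  rw [Finset.sum_eq_single t]
  · rw [if_pos, mul_one]
    exact ⟨1, by omega⟩
  · intro j hj hjt
    rw [Finset.mem_range] at hj
    rw [if_neg, mul_zero]
    intro hd
    obtain ⟨k, hk⟩ := hd
    have h1 : k < 2 := by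
      by_contra hk2
      have : n * 2 ≤ n * k := Nat.mul_le_mul_left _ (by omega)
      omega
    interval_cases k <;> omega
  · simp [ht]

/-- Modulo X^n - 1 only degrees below n matter, and such a polynomial writes its coefficients,
reversed, into the first n terms of its multiple of the impulse. -/
lemma aeval_shift_impulse_eq_zero_iff {n : ℕ} (hn : 0 < n) (f : K[X]) :
    aeval (shift K) f (impulse K n) = 0 ↔ (X ^ n - 1 : K[X]) ∣ f := by
  refine ⟨fun h => ?_, aeval_shift_impulse_eq_zero_of_dvd⟩
  have hm : (X ^ n - 1 : K[X]).Monic := by simpa using monic_X_pow_sub_C (1 : K) hn.ne'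
  rw [← modByMonic_eq_zero_iff_dvd hm]
  set r := f %ₘ (X ^ n - 1) with hr
  have h0 : aeval (shift K) r (impulse K n) = 0 := by
    rw [hr, modByMonic_eq_sub_mul_div, map_sub, LinearMap.sub_apply, h,
      aeval_shift_impulse_eq_zero_of_dvd (dvd_mul_right _ _), sub_zero]
  have hdeg : r.degree < n := by
    have := degree_modByMonic_lt f hm
    rwa [show (X ^ n - 1 : K[X]) = X ^ n - C 1 by simp, degree_X_pow_sub_C hn] at this
  have hsum : r = ∑ j ∈ Finset.range n, C (r.coeff (n - 1 - j)) * X ^ (n - 1 - j) := by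
    rw [Finset.sum_range_reflect (fun j => C (r.coeff j) * X ^ j)]
    simp only [C_mul_X_pow_eq_monomial]
    by_cases hr0 : r = 0
    · simp [hr0]
    exact r.as_sum_range' n ((natDegree_lt_iff_degree_lt hr0).2 hdeg)
  ext j
  rw [coeff_zero]
  by_cases hj : j < n
  · have := congr_fun h0 (n - 1 - j)
    rw [hsum, aeval_shift_impulse_sum _ (by omega)] at this
    simpa [show n - 1 - (n - 1 - j) = j by omega] using this
  · exact coeff_eq_zero_of_degree_lt (hdeg.trans_le (by exact_mod_cast not_lt.1 hj))

/-- The reversed generating polynomial of the first `n` terms of `S`. -/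
noncomputable def revPoly (n : ℕ) (S : ℕ → K) : K[X] :=
  ∑ j ∈ Finset.range n, C (S j) * X ^ (n - 1 - j)

lemma aeval_shift_periodic {n : ℕ} {S : ℕ → K} (hS : Function.Periodic S n) (f : K[X]) :
    Function.Periodic (aeval (shift K) f S) n := by
  intro t
  simp only [aeval_shift_apply]
  congr 1
  ext i a
  rw [show t + n + i = t + i + n by ring, hS]

lemma impulse_periodic (n : ℕ) : Function.Periodic (impulse K n) n := by
  intro t
  simp only [impulse]
  simp [show t + n + 1 = t + 1 + n by ring]

lemma aeval_shift_revPoly {n : ℕ} (hn : 0 < n) {S : ℕ → K} (hS : Function.Periodic S n) :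
    aeval (shift K) (revPoly n S) (impulse K n) = S := by
  ext t
  rw [← (aeval_shift_periodic (impulse_periodic n) _).map_mod_nat t, ← hS.map_mod_nat t, revPoly,
    aeval_shift_impulse_sum _ (Nat.mod_lt _ hn)]

/-- If `S` is generated by `P` with period `n`, and `P` is a multiple of `D` up to a factor
coprime to the cofactor `Q` of `D` in `X ^ n - 1`, then `Q` is the minimal polynomial of `S`. -/
theorem minimalPolynomial_of_factorization {n : ℕ} (hn : 0 < n) {S : ℕ → K} {P D Q P' : K[X]}
    (hS : S = aeval (shift K) P (impulse K n)) (hDQ : (X ^ n - 1 : K[X]) = D * Q)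
    (hQ : Q.Monic) (hP : P = D * P') (hco : IsCoprime P' Q) :
    linearComplexity S = Q.natDegree ∧ ∀ f, IsMinimalPolynomial S f ↔ f = Q := by
  refine minimalPolynomial_of_annihilator hQ fun f => ?_
  have hD : D ≠ 0 := by
    rintro rfl
    have hm : (X ^ n - 1 : K[X]).Monic := by simpa using monic_X_pow_sub_C (1 : K) hn.ne'
    exact hm.ne_zero (by rw [hDQ, zero_mul])
  rw [hS, ← Module.End.mul_apply, ← map_mul, aeval_shift_impulse_eq_zero_iff hn, hDQ, hP,
    show f * (D * P') = D * (P' * f) by ring, mul_dvd_mul_iff_left hD]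
  exact ⟨fun h => hco.symm.dvd_of_dvd_mul_left h, fun h => h.mul_left _⟩

/-- The nonzero places of the impulse of period 2n are odd, and even shifts keep them odd; halving
indices recovers period n. -/
lemma aeval_shift_expand_impulse (f : K[X]) (n t : ℕ) :
    aeval (shift K) (expand K 2 f) (impulse K (2 * n)) t =
      if Odd t then aeval (shift K) f (impulse K n) (t / 2) else 0 := by
  induction f using Polynomial.induction_on' with
  | add p q hp hq =>
    simp only [map_add, LinearMap.add_apply, Pi.add_apply, hp, hq]
    split_ifs <;> simp
  | monomial i a =>
    simp only [expand_monomial, aeval_monomial, Module.End.mul_apply, Module.algebraMap_end_apply,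
      Pi.smul_apply, shift_pow_apply, smul_eq_mul, impulse]
    split_ifs with h1 h2 h3 h4 h5
    · rfl
    · exfalso
      apply h3
      obtain ⟨k, rfl⟩ := h2
      obtain ⟨d, hd⟩ := h1
      exact ⟨d, by rw [mul_assoc] at hd; omega⟩
    · exfalso
      obtain ⟨d, hd⟩ := h1
      rw [mul_assoc] at hd
      apply h2
      rw [← Nat.not_even_iff_odd]
      rintro ⟨k, rfl⟩
      omega
    · exfalso
      obtain ⟨k, rfl⟩ := h4
      obtain ⟨d, hd⟩ := h5
      exact h1 ⟨d, by rw [mul_assoc]; omega⟩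
    · rfl
    · simp

end Sequences

/-- The generating polynomial of the interleaving of `T` with a shift of its complement. -/
lemma interleave_complement_eq {n : ℕ} (hn : 0 < n) {T : ℕ → ZMod 2} (hT : Function.Periodic T n)
    (e : ℕ) :
    interleave ![T, leftShift e (complement T)] =
      aeval (shift (ZMod 2)) ((X + X ^ (2 * e)) * revPoly n T ^ 2 +
        (∑ i ∈ Finset.range n, X ^ i) ^ 2) (impulse (ZMod 2) (2 * n)) := by
  set P := revPoly n T with hP
  have hTP : T = aeval (shift (ZMod 2)) P (impulse (ZMod 2) n) := (aeval_shift_revPoly hn hT).symm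
  have hone : aeval (shift (ZMod 2)) (∑ i ∈ Finset.range n, X ^ i : (ZMod 2)[X])
      (impulse (ZMod 2) n) = fun _ => 1 := by
    have : (∑ i ∈ Finset.range n, X ^ i : (ZMod 2)[X]) = revPoly n fun _ => 1 := by
      rw [revPoly]
      simp only [C_1, one_mul]
      rw [Finset.sum_range_reflect (fun j => (X ^ j : (ZMod 2)[X]))]
    rw [this, aeval_shift_revPoly hn (fun _ => rfl)]
  -- Over 𝔽₂ squaring is the substitution of X² for X. The second summand fills the odd places with
  -- the shifted complement; the extra factor X moves T to the even places.
  have hpoly : (X + X ^ (2 * e)) * P ^ 2 + (∑ i ∈ Finset.range n, X ^ i : (ZMod 2)[X]) ^ 2 =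
      X * expand (ZMod 2) 2 P + expand (ZMod 2) 2 (X ^ e * P + ∑ i ∈ Finset.range n, X ^ i) := by
    simp only [ZMod.expand_card]
    have h2 : (2 : (ZMod 2)[X]) = 0 := by
      have : ((2 : ℕ) : (ZMod 2)[X]) = 0 := CharP.cast_eq_zero _ 2
      simpa using this
    linear_combination (-(X ^ e * P * ∑ i ∈ Finset.range n, X ^ i)) * h2
  rw [hpoly]
  ext t
  rw [map_add, LinearMap.add_apply, Pi.add_apply, map_mul, Module.End.mul_apply, aeval_X]
  change _ = aeval (shift (ZMod 2)) (expand (ZMod 2) 2 P) (impulse (ZMod 2) (2 * n)) (t + 1) + _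
  simp only [aeval_shift_expand_impulse]
  rw [map_add, LinearMap.add_apply, Pi.add_apply, hone, map_mul, Module.End.mul_apply, map_pow,
    aeval_X, shift_pow_apply, ← hTP]
  simp only [interleave]
  rcases Nat.even_or_odd t with ht | ht
  · have h1 : Fin.ofNat 2 t = 0 := by
      apply Fin.ext
      simpa using Nat.even_iff.1 ht
    rw [h1, if_pos ht.add_one, if_neg (Nat.not_odd_iff_even.2 ht)]
    obtain ⟨k, rfl⟩ := ht
    simp only [Matrix.cons_val_zero, add_zero]
    rw [show (k + k) / 2 = k by omega, show (k + k + 1) / 2 = k by omega]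
  · have h1 : Fin.ofNat 2 t = 1 := by
      apply Fin.ext
      simpa using Nat.odd_iff.1 ht
    rw [h1, if_neg (Nat.not_odd_iff_even.2 ht.add_one), if_pos ht]
    simp only [Matrix.cons_val_one, Matrix.cons_val_fin_one, zero_add, leftShift, complement]
    rw [sub_eq_add_neg, show (-1 : ZMod 2) = 1 by decide]

/-! ### Polynomials over 𝔽₂ and roots of unity in characteristic 2 -/

section BinaryPolynomials

lemma two_eq_zero_poly : (2 : (ZMod 2)[X]) = 0 := by
  have : ((2 : ℕ) : (ZMod 2)[X]) = 0 := CharP.cast_eq_zero _ 2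
  simpa using this

lemma X_pow_add_one_eq (n : ℕ) : (X ^ n + 1 : (ZMod 2)[X]) = X ^ n - 1 := by
  linear_combination two_eq_zero_poly

lemma X_pow_two_mul_sub_one (n : ℕ) : (X ^ (2 * n) - 1 : (ZMod 2)[X]) = (X ^ n - 1) ^ 2 := by
  rw [mul_comm, pow_mul]
  linear_combination (X ^ n - 1 : (ZMod 2)[X]) * two_eq_zero_poly

lemma X_pow_sub_one_monic {n : ℕ} (hn : 0 < n) : (X ^ n - 1 : (ZMod 2)[X]).Monic := by
  simpa using monic_X_pow_sub_C (1 : ZMod 2) hn.ne'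

lemma X_pow_sub_one_natDegree (n : ℕ) : (X ^ n - 1 : (ZMod 2)[X]).natDegree = n := by
  simpa using natDegree_X_pow_sub_C (n := n) (r := (1 : ZMod 2))

lemma X_pow_sub_one_dvd {a b : ℕ} (h : a ∣ b) : (X ^ a - 1 : (ZMod 2)[X]) ∣ X ^ b - 1 := by
  obtain ⟨c, rfl⟩ := h
  simpa [pow_mul] using sub_dvd_pow_sub_pow (X ^ a : (ZMod 2)[X]) 1 c

lemma X_pow_sub_one_separable {n : ℕ} (hn : Odd n) : (X ^ n - 1 : (ZMod 2)[X]).Separable := by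
  rw [X_pow_sub_one_separable_iff]
  intro h
  rw [ZMod.natCast_eq_zero_iff] at h
  exact (Nat.not_even_iff_odd.2 hn) (even_iff_two_dvd.2 h)

lemma coprime_of_mul_eq_X_pow_sub_one {n : ℕ} (hn : Odd n) {a b : (ZMod 2)[X]}
    (h : X ^ n - 1 = a * b) : IsCoprime a b :=
  Separable.isCoprime (h ▸ X_pow_sub_one_separable hn)

variable {K : Type*} [Field K] [Algebra (ZMod 2) K]

lemma aeval_X_pow_sub_one_eq_zero {n : ℕ} {β : K} :
    aeval β (X ^ n - 1 : (ZMod 2)[X]) = 0 ↔ β ^ n = 1 := by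
  simp [sub_eq_zero]

lemma aeval_eq_zero_of_dvd' {f g : (ZMod 2)[X]} {β : K} (h : f ∣ g) (hf : aeval β f = 0) :
    aeval β g = 0 := by
  obtain ⟨c, rfl⟩ := h
  rw [map_mul, hf, zero_mul]

lemma not_both_roots {f g : (ZMod 2)[X]} (h : IsCoprime f g) {β : K} (hf : aeval β f = 0)
    (hg : aeval β g = 0) : False := by
  rcases aeval_ne_zero_of_isCoprime h β with h | h
  · exact h hf
  · exact h hg

/-- The exponent `|2 e - 1|`, the odd integer with `X + X ^ (2 e) ∼ X ^ k - 1`. -/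
def oddShift (e : ℕ) : ℕ := (-2 * (e : ℤ) + 1).natAbs

lemma oddShift_odd (e : ℕ) : Odd (oddShift e) := by
  rw [oddShift, Int.natAbs_odd]
  exact ⟨-e, by ring⟩

/-- The power of X pulled out is harmless at roots of unity, and oddness of the exponent makes the
other factor separable. -/
lemma exists_X_add_X_pow_eq (e : ℕ) : ∃ u : (ZMod 2)[X], (u = 1 ∨ u = X) ∧
    X + X ^ (2 * e) = u * (X ^ oddShift e - 1) := by
  rcases e with _ | e
  · refine ⟨1, Or.inl rfl, ?_⟩
    simp only [oddShift, mul_zero, pow_zero, one_mul]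
    simp only [Nat.cast_zero, mul_zero, zero_add, Int.natAbs_one, pow_one]
    linear_combination two_eq_zero_poly
  · refine ⟨X, Or.inr rfl, ?_⟩
    have : oddShift (e + 1) = 2 * e + 1 := by
      rw [oddShift]
      omega
    rw [this]
    linear_combination (X : (ZMod 2)[X]) * two_eq_zero_poly

lemma aeval_ne_zero_of_eq_one_or_X {u : (ZMod 2)[X]} (hu : u = 1 ∨ u = X) {β : K} {n : ℕ}
    (hn : 0 < n) (hβ : β ^ n = 1) : aeval β u ≠ 0 := by
  rcases hu with rfl | rfl
  · simp
  · rw [aeval_X]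
    rintro rfl
    rw [zero_pow hn.ne'] at hβ
    exact zero_ne_one hβ

variable (K) [IsAlgClosed K]

lemma isCoprime_of_no_common_root {f g : (ZMod 2)[X]}
    (h : ∀ β : K, aeval β g = 0 → aeval β f ≠ 0) : IsCoprime f g := by
  refine (isCoprime_iff_aeval_ne_zero_of_isAlgClosed (ZMod 2) K f g).2 fun β => ?_
  by_cases hg : aeval β g = 0
  · exact Or.inl (h β hg)
  · exact Or.inr hg

/-- For odd n the divisor is separable, so inclusion of root sets suffices. -/
lemma dvd_of_roots {n : ℕ} (hn : Odd n) {f q : (ZMod 2)[X]} (hq : q ∣ X ^ n - 1)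
    (h : ∀ β : K, aeval β q = 0 → aeval β f = 0) : q ∣ f := by
  have hsep : q.Separable := (X_pow_sub_one_separable hn).of_dvd hq
  by_cases hf : f = 0
  · simp [hf]
  rw [← map_dvd_map' (algebraMap (ZMod 2) K)]
  have hq0 : q.map (algebraMap (ZMod 2) K) ≠ 0 :=
    (Polynomial.map_ne_zero_iff (algebraMap (ZMod 2) K).injective).2 hsep.ne_zero
  have hf0 : f.map (algebraMap (ZMod 2) K) ≠ 0 :=
    (Polynomial.map_ne_zero_iff (algebraMap (ZMod 2) K).injective).2 hf
  refine (IsAlgClosed.splits _).dvd_of_roots_le_roots hq0 ?_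
  rw [Multiset.le_iff_subset (nodup_roots hsep.map)]
  intro β hβ
  rw [mem_roots hq0, IsRoot.def, eval_map_algebraMap] at hβ
  rw [mem_roots hf0, IsRoot.def, eval_map_algebraMap]
  exact h β hβ

/-- A polynomial vanishing at the `n`-th roots of unity, with a multiple zero at those different
from `1`, is a multiple of `(X ^ n - 1) ^ 2 / (X - 1)`. -/
lemma exists_factor_of_double_roots {n : ℕ} (hn : Odd n) {f q : (ZMod 2)[X]}
    (hq : (X ^ n - 1 : (ZMod 2)[X]) = (X - 1) * q)
    (h0 : ∀ β : K, β ^ n = 1 → aeval β f = 0)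
    (h1 : ∀ β : K, β ^ n = 1 → β ≠ 1 → aeval β (derivative f) = 0)
    (h2 : aeval (1 : K) (derivative f) ≠ 0) :
    ∃ f' : (ZMod 2)[X], f = (X - 1) * q ^ 2 * f' ∧ aeval (1 : K) f' ≠ 0 := by
  have hqd : q ∣ X ^ n - 1 := Dvd.intro_left _ hq.symm
  have hco : IsCoprime (X - 1) q := coprime_of_mul_eq_X_pow_sub_one hn hq
  have hroot : ∀ β : K, aeval β q = 0 → β ^ n = 1 ∧ β ≠ 1 := by
    refine fun β hβ => ⟨aeval_X_pow_sub_one_eq_zero.1 (aeval_eq_zero_of_dvd' hqd hβ), ?_⟩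
    rintro rfl
    exact not_both_roots hco (β := (1 : K)) (by simp) hβ
  obtain ⟨a, rfl⟩ := dvd_of_roots K hn hqd fun β hβ => h0 β (hroot β hβ).1
  -- At a root of q the derivative of q a is q' a, and q' does not vanish there.
  obtain ⟨b, rfl⟩ : q ∣ a := by
    refine dvd_of_roots K hn hqd fun β hβ => ?_
    have := h1 β (hroot β hβ).1 (hroot β hβ).2
    rw [derivative_mul, map_add, map_mul, map_mul, hβ, zero_mul, add_zero] at this
    refine (mul_eq_zero.1 this).resolve_left fun hd => ?_
    have hs : q.Separable := (X_pow_sub_one_separable hn).of_dvd hqd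
    exact not_both_roots hs hβ hd
  have hq1 : aeval (1 : K) q ≠ 0 := fun h => (hroot 1 h).2 rfl
  obtain ⟨c, rfl⟩ : (X - 1 : (ZMod 2)[X]) ∣ b := by
    refine dvd_of_roots K hn (Dvd.intro _ hq.symm) fun β hβ => ?_
    have hβ1 : β = 1 := by simpa [sub_eq_zero] using hβ
    subst hβ1
    have := h0 1 (one_pow n)
    simpa [hq1] using this
  refine ⟨c, by ring, fun hc => h2 ?_⟩
  -- Written this way, the derivative at 1 is q(1)² c(1), which would be zero.
  have : q * (q * ((X - 1) * c)) = q ^ 2 * ((X - 1) * c) := by ring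
  rw [this, derivative_mul, derivative_pow, derivative_mul]
  simp [hc, CharTwo.two_eq_zero]

end BinaryPolynomials

/-! ### Minimal polynomials of interleavings from the zeros of the generating polynomial -/

section Complexity

variable (K : Type*) [Field K] [Algebra (ZMod 2) K] [IsAlgClosed K]

/-- Minimal polynomials in the case of a sequence of full linear complexity. -/
theorem minimalPolynomial_interleave_of_coprime {h : ℕ} (hh : 0 < h) {T : ℕ → ZMod 2}
    (hT : Function.Periodic T (2 * h))
    (hroot : ∀ β : K, β ^ (2 * h) = 1 → aeval β (revPoly (2 * h) T) ≠ 0) (e : ℕ) :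
    linearComplexity T = 2 * h ∧ ∃ Q : (ZMod 2)[X],
      (X ^ (2 * (2 * h)) - 1 : (ZMod 2)[X]) = (X ^ (oddShift e).gcd h - 1) * Q ∧
      linearComplexity (interleave ![T, leftShift e (complement T)]) = Q.natDegree ∧
      ∀ f, IsMinimalPolynomial (interleave ![T, leftShift e (complement T)]) f ↔ f = Q := by
  have h2 : 0 < 2 * h := by omega
  set P := revPoly (2 * h) T with hP
  constructor
  · rw [← X_pow_sub_one_natDegree (2 * h)]
    refine (minimalPolynomial_of_factorization h2 (aeval_shift_revPoly h2 hT).symm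
      (one_mul _).symm (X_pow_sub_one_monic h2) (one_mul _).symm ?_).1
    exact isCoprime_of_no_common_root K fun β hβ => hroot β (aeval_X_pow_sub_one_eq_zero.1 hβ)
  obtain ⟨u, hu, hue⟩ := exists_X_add_X_pow_eq e
  set k := oddShift e with hk
  set G := k.gcd h with hG
  have hGpos : 0 < G := Nat.gcd_pos_of_pos_right _ hh
  obtain ⟨k', hk'⟩ := X_pow_sub_one_dvd (Nat.gcd_dvd_left k h)
  obtain ⟨c, hc⟩ := X_pow_sub_one_dvd (Nat.gcd_dvd_right k h)
  rw [← hG] at hk' hc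
  have hgeo : (∑ i ∈ Finset.range (2 * h), X ^ i : (ZMod 2)[X]) =
      (∑ i ∈ Finset.range h, X ^ i) * (X ^ h - 1) := by
    have hX1 : (X - 1 : (ZMod 2)[X]) ≠ 0 := by simpa using X_sub_C_ne_zero (1 : ZMod 2)
    apply mul_right_cancel₀ hX1
    rw [geom_sum_mul, X_pow_two_mul_sub_one, mul_right_comm, geom_sum_mul, sq]
  have hDQ : (X ^ (2 * (2 * h)) - 1 : (ZMod 2)[X]) = (X ^ G - 1) * (c * (X ^ h - 1) ^ 3) := by
    rw [X_pow_two_mul_sub_one, X_pow_two_mul_sub_one]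
    linear_combination (X ^ h - 1 : (ZMod 2)[X]) ^ 3 * hc
  refine ⟨c * (X ^ h - 1) ^ 3, hDQ, ?_⟩
  -- X^(2N) - 1 is (X^h - 1)⁴ and the all-ones term contains (X^h - 1)², so X^G - 1 divides both
  -- summands of the generating polynomial.
  refine minimalPolynomial_of_factorization (n := 2 * (2 * h)) (by omega)
    (interleave_complement_eq h2 hT e) hDQ ?_
    (P' := u * k' * P ^ 2 + c * (X ^ h - 1) * (∑ i ∈ Finset.range h, X ^ i) ^ 2) ?_ ?_
  · refine (X_pow_sub_one_monic hGpos).of_mul_monic_left ?_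
    rw [← hDQ]
    exact X_pow_sub_one_monic (by omega)
  · rw [hgeo, hue, hk']
    linear_combination (∑ i ∈ Finset.range h, X ^ i : (ZMod 2)[X]) ^ 2 * (X ^ h - 1) * hc
  · refine isCoprime_of_no_common_root K fun β hβ hβ' => ?_
    have hβh : aeval β (X ^ h - 1 : (ZMod 2)[X]) = 0 := by
      rw [map_mul, map_pow, mul_eq_zero] at hβ
      rcases hβ with hβ | hβ
      · exact aeval_eq_zero_of_dvd' (Dvd.intro_left _ hc.symm) hβ
      · exact pow_eq_zero_iff (by norm_num) |>.1 hβ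
    have hβ1 : β ^ h = 1 := aeval_X_pow_sub_one_eq_zero.1 hβh
    -- The second summand of `P'` contains X^h - 1 and dies at β, leaving u k' P².
    rw [map_add, map_mul (aeval β) (c * _), map_mul (aeval β) c, hβh, mul_zero, zero_mul, add_zero,
      map_mul, map_mul, map_pow, mul_eq_zero, mul_eq_zero] at hβ'
    rcases hβ' with (hβ' | hβ') | hβ'
    · exact aeval_ne_zero_of_eq_one_or_X hu hh hβ1 hβ'
    -- Here β would be a root of X^G - 1 and of its cofactor in the separable polynomial X^k - 1.
    · have h3 : β ^ k = 1 :=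
        aeval_X_pow_sub_one_eq_zero.1 (aeval_eq_zero_of_dvd' (Dvd.intro_left _ hk'.symm) hβ')
      refine not_both_roots (coprime_of_mul_eq_X_pow_sub_one (oddShift_odd e) hk') (β := β) ?_ hβ'
      exact aeval_X_pow_sub_one_eq_zero.2 (pow_gcd_eq_one.2 ⟨h3, hβ1⟩)
    · refine hroot β ?_ (pow_eq_zero_iff (by norm_num) |>.1 hβ')
      rw [mul_comm, pow_mul, hβ1, one_pow]

/-- Minimal polynomials in the case of a sequence with defect `(X ^ ν - 1) ^ 2 / (X - 1)`. -/
theorem minimalPolynomial_interleave_of_defect {r ν : ℕ} (hr : Odd r) (hν : Odd ν)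
    {T : ℕ → ZMod 2} (hT : Function.Periodic T (2 * (r * ν)))
    (hroot : ∀ β : K, β ^ (r * ν) = 1 →
      (aeval β (revPoly (2 * (r * ν)) T) = 0 ↔ β ^ ν = 1))
    (hder : ∀ β : K, β ^ ν = 1 →
      (aeval β (derivative (revPoly (2 * (r * ν)) T)) = 0 ↔ β ≠ 1)) (e : ℕ) :
    linearComplexity T + 2 * ν = 2 * (r * ν) + 1 ∧ ∃ Q : (ZMod 2)[X],
      ((X ^ (2 * (2 * (r * ν))) - 1) * (X ^ 2 - 1) * (X ^ (oddShift e).gcd ν - 1) : (ZMod 2)[X]) =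
        (X ^ (4 * ν) - 1) * (X ^ (oddShift e).gcd (r * ν) - 1) * Q ∧
      linearComplexity (interleave ![T, leftShift e (complement T)]) = Q.natDegree ∧
      ∀ f, IsMinimalPolynomial (interleave ![T, leftShift e (complement T)]) f ↔ f = Q := by
  have hrν : Odd (r * ν) := hr.mul hν
  have h1 : 0 < r * ν := hrν.pos
  have h2 : 0 < 2 * (r * ν) := by omega
  set P := revPoly (2 * (r * ν)) T with hP
  obtain ⟨q, hq⟩ : (X - 1 : (ZMod 2)[X]) ∣ X ^ ν - 1 := by
    simpa using X_pow_sub_one_dvd (one_dvd ν)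
  obtain ⟨E, hE⟩ := X_pow_sub_one_dvd (Dvd.intro_left r rfl : ν ∣ r * ν)
  have hEco := coprime_of_mul_eq_X_pow_sub_one hrν hE
  have hE1 : ∀ β : K, aeval β E = 0 → β ^ (r * ν) = 1 ∧ β ^ ν ≠ 1 := fun β hβ =>
    ⟨aeval_X_pow_sub_one_eq_zero.1 (aeval_eq_zero_of_dvd' (Dvd.intro_left _ hE.symm) hβ),
      fun h => not_both_roots hEco (aeval_X_pow_sub_one_eq_zero.2 h) hβ⟩
  obtain ⟨T', hPT, hT'1⟩ := exists_factor_of_double_roots K hν hq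
    (fun β hβ => (hroot β (by rw [mul_comm, pow_mul, hβ, one_pow])).2 hβ)
    (fun β hβ hβ1 => (hder β hβ).2 hβ1)
    (fun h => (hder 1 (one_pow _)).1 h rfl)
  -- Zeros of T' at roots of q are irrelevant: q² already exhausts their multiplicity in X^N - 1.
  have hT'E : ∀ β : K, aeval β E = 0 → aeval β T' ≠ 0 := by
    intro β hβ h0
    refine (hE1 β hβ).2 ((hroot β (hE1 β hβ).1).1 ?_)
    rw [hPT, map_mul, h0, mul_zero]
  have hXm : (X - 1 : (ZMod 2)[X]).Monic := by simpa using monic_X_sub_C (1 : ZMod 2)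
  have hEm : E.Monic := by
    refine (X_pow_sub_one_monic hν.pos).of_mul_monic_left ?_
    rw [← hE]
    exact X_pow_sub_one_monic h1
  constructor
  · have hL : linearComplexity T = ((X - 1) * E ^ 2 : (ZMod 2)[X]).natDegree := by
      refine (minimalPolynomial_of_factorization h2 (aeval_shift_revPoly h2 hT).symm
        (D := (X - 1) * q ^ 2) ?_ (hXm.mul (hEm.pow 2)) hPT ?_).1
      · rw [X_pow_two_mul_sub_one, hE, hq]
        ring
      · refine isCoprime_of_no_common_root K fun β hβ => ?_
        rw [map_mul, mul_eq_zero, map_pow, pow_eq_zero_iff (by norm_num)] at hβ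
        rcases hβ with hβ | hβ
        · have hβ1 : β = 1 := by simpa [sub_eq_zero] using hβ
          rwa [hβ1]
        · exact hT'E β hβ
    have hdeg : ((X - 1) * E ^ 2 * (X ^ ν - 1) ^ 2 : (ZMod 2)[X]) =
        (X ^ (2 * (r * ν)) - 1) * (X ^ 1 - 1) := by
      rw [X_pow_two_mul_sub_one, hE]
      ring
    have := congr_arg natDegree hdeg
    rw [Monic.natDegree_mul (hXm.mul (hEm.pow 2)) ((X_pow_sub_one_monic hν.pos).pow 2),
      Monic.natDegree_mul (X_pow_sub_one_monic h2) (X_pow_sub_one_monic one_pos),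
      (X_pow_sub_one_monic hν.pos).natDegree_pow] at this
    simpa only [X_pow_sub_one_natDegree, ← hL] using this
  obtain ⟨u, hu, hue⟩ := exists_X_add_X_pow_eq e
  set k := oddShift e with hk
  have hk_odd : Odd k := oddShift_odd e
  set H1 := k.gcd (r * ν) with hH1
  set H0 := k.gcd ν with hH0
  have hH01 : H0 ∣ H1 := Nat.gcd_dvd_gcd_of_dvd_right _ (Dvd.intro_left r rfl)
  have hH1_odd : Odd H1 := Odd.of_dvd_nat hk_odd (Nat.gcd_dvd_left _ _)
  obtain ⟨D, hD⟩ := X_pow_sub_one_dvd hH01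
  obtain ⟨w, hw⟩ := X_pow_sub_one_dvd (Nat.gcd_dvd_left k (r * ν))
  rw [← hH1] at hw
  have hwco := coprime_of_mul_eq_X_pow_sub_one hk_odd hw
  have hDco := coprime_of_mul_eq_X_pow_sub_one hH1_odd hD
  -- The order of a common root divides both k and ν, hence H0, so it would be a root of both
  -- factors of X^H1 - 1.
  have hDν : IsCoprime D (X ^ ν - 1) := by
    refine isCoprime_of_no_common_root K fun β hβ hβ' => ?_
    have hβ1 : β ^ H1 = 1 :=
      aeval_X_pow_sub_one_eq_zero.1 (aeval_eq_zero_of_dvd' (Dvd.intro_left _ hD.symm) hβ')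
    have hβk : β ^ k = 1 := by
      obtain ⟨c, hc⟩ : H1 ∣ k := Nat.gcd_dvd_left _ _
      rw [hc, pow_mul, hβ1, one_pow]
    refine not_both_roots hDco (β := β) (aeval_X_pow_sub_one_eq_zero.2 ?_) hβ'
    exact pow_gcd_eq_one.2 ⟨hβk, aeval_X_pow_sub_one_eq_zero.1 hβ⟩
  obtain ⟨c, hc⟩ : D ∣ E := by
    refine hDν.dvd_of_dvd_mul_left ?_
    rw [← hE]
    exact (Dvd.intro_left _ hD.symm).trans (X_pow_sub_one_dvd (Nat.gcd_dvd_right _ _))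
  have hgeo : (∑ i ∈ Finset.range (2 * (r * ν)), X ^ i : (ZMod 2)[X]) =
      (X - 1) * q ^ 2 * E ^ 2 := by
    apply mul_right_cancel₀ hXm.ne_zero
    rw [geom_sum_mul, X_pow_two_mul_sub_one, hE, hq]
    ring
  have hDm : D.Monic := by
    refine (X_pow_sub_one_monic (Nat.gcd_pos_of_pos_left ν hk_odd.pos)).of_mul_monic_left ?_
    rw [← hD]
    exact X_pow_sub_one_monic hH1_odd.pos
  have hcm : c.Monic := hDm.of_mul_monic_left (hc ▸ hEm)
  refine ⟨c * E ^ 3 * (X - 1) ^ 2, ?_, ?_⟩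
  · rw [X_pow_two_mul_sub_one, X_pow_two_mul_sub_one, show 4 * ν = 2 * (2 * ν) by ring,
      X_pow_two_mul_sub_one, X_pow_two_mul_sub_one,
      show (X ^ 2 - 1 : (ZMod 2)[X]) = (X - 1) ^ 2 by simpa using X_pow_two_mul_sub_one 1, hE, hD]
    linear_combination (X ^ ν - 1) ^ 4 * (X - 1) ^ 2 * (X ^ H0 - 1) * E ^ 3 * hc
  -- X^(2N) - 1 is ((X - 1) q E)⁴. Both summands contain (X - 1)² q⁴, and of E they share the part
  -- D.
  refine minimalPolynomial_of_factorization (n := 2 * (2 * (r * ν))) (by omega)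
    (interleave_complement_eq h2 hT e) (D := (X - 1) ^ 2 * q ^ 4 * D)
    (P' := u * ((X ^ H0 - 1) * w) * T' ^ 2 + c * E ^ 3) ?_
    ((hcm.mul (hEm.pow 3)).mul (hXm.pow 2)) ?_ ?_
  · rw [X_pow_two_mul_sub_one, X_pow_two_mul_sub_one, hE, hq]
    linear_combination (X - 1) ^ 4 * q ^ 4 * E ^ 3 * hc
  · rw [hgeo, hue, hw, hD, ← hP, hPT]
    linear_combination (X - 1) ^ 2 * q ^ 4 * E ^ 3 * hc
  · refine isCoprime_of_no_common_root K fun β hβ hβ' => ?_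
    by_cases hβE : aeval β E = 0
    · obtain ⟨hβ1, hβν⟩ := hE1 β hβE
      simp only [map_add, map_mul, map_pow, hβE] at hβ'
      simp only [ne_eq, OfNat.ofNat_ne_zero, not_false_eq_true, zero_pow, mul_zero, add_zero,
        mul_eq_zero, pow_eq_zero_iff, hT'E β hβE, or_false] at hβ'
      rcases hβ' with hβ' | hβ' | hβ'
      · exact aeval_ne_zero_of_eq_one_or_X hu h1 hβ1 hβ'
      · apply hβν
        obtain ⟨d, hd⟩ : H0 ∣ ν := Nat.gcd_dvd_right _ _
        rw [hd, pow_mul]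
        rw [map_sub, map_pow, aeval_X, map_one, sub_eq_zero] at hβ'
        rw [hβ', one_pow]
      · have hβk : β ^ k = 1 :=
          aeval_X_pow_sub_one_eq_zero.1 (aeval_eq_zero_of_dvd' (Dvd.intro_left _ hw.symm) hβ')
        exact not_both_roots hwco (β := β)
          (aeval_X_pow_sub_one_eq_zero.2 (pow_gcd_eq_one.2 ⟨hβk, hβ1⟩)) hβ'
    -- Since c divides E, only β = 1 is left; there X^H0 - 1 vanishes while c E³ does not.
    · have hβc : aeval β c ≠ 0 := fun h =>
        hβE (aeval_eq_zero_of_dvd' (Dvd.intro_left _ hc.symm) h)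
      have hβ1 : β = 1 := by
        simpa [hβE, hβc, sub_eq_zero] using hβ
      subst hβ1
      simp [hβE, hβc] at hβ'

end Complexity

/-! ### Arithmetic of G, H₀ and H₁ -/

lemma gcd_umod (a : ℤ) {n : ℕ} (hn : 0 < n) : Nat.gcd (umod a n) n = Nat.gcd a.natAbs n := by
  have h0 : 0 ≤ (a - 1) % (n : ℤ) := Int.emod_nonneg _ (by omega)
  have h1 : ((umod a n : ℕ) : ℤ) = (a - 1) % n + 1 := Int.toNat_of_nonneg (by omega)
  have h2 : Int.gcd (umod a n) n = Int.gcd a n := by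
    rw [h1, ← Int.gcd_emod, Int.emod_add_emod, sub_add_cancel, Int.gcd_emod]
  simpa [Int.gcd_def] using h2

lemma gcdH0_eq {ν : ℕ} (hν : 0 < ν) (e : ℕ) : gcdH0 ν e = (oddShift e).gcd ν := gcd_umod _ hν

lemma gcdH1_eq {h : ℕ} (hh : 0 < h) (e : ℕ) : gcdH1 (2 * h) e = (oddShift e).gcd h := by
  rw [gcdH1, Nat.mul_div_cancel_left _ two_pos, gcd_umod _ hh, oddShift]

/-- The shift exponent is odd, so the powers of 2 in h do not affect the gcd. -/
lemma gcdG_eq {h : ℕ} (hh : 0 < h) (e : ℕ) : gcdG (2 * h) e = (oddShift e).gcd h := by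
  have hv : padicValNat 2 (2 * h) = padicValNat 2 h + 1 := by
    rw [padicValNat.mul two_ne_zero hh.ne', padicValNat.self one_lt_two, add_comm]
  obtain ⟨M, hM⟩ : 2 ^ padicValNat 2 h ∣ h := pow_padicValNat_dvd
  have hM' : 2 * h / 2 ^ padicValNat 2 (2 * h) = M := by
    rw [hv]
    generalize padicValNat 2 h = v at hM
    rw [hM, ← mul_assoc, ← pow_succ', Nat.mul_div_cancel_left _ (by positivity)]
  have hMpos : 0 < M := Nat.pos_of_ne_zero fun h0 => hh.ne' (by rw [hM, h0, mul_zero])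
  rw [gcdG, hM', gcd_umod _ hMpos]
  conv_rhs => rw [hM]
  exact (Nat.Coprime.gcd_mul_left_cancel_right _
    ((Nat.coprime_two_left.2 (oddShift_odd e)).pow_left _)).symm

/-! ### Quadratic character with values in 𝔽₂ -/

section Nonresidues

open Classical in
/-- The indicator of the non-squares. -/
noncomputable def nonres {F : Type*} [Field F] (x : F) : ZMod 2 := if IsSquare x then 0 else 1

lemma nonres_eq_one_iff {F : Type*} [Field F] {x : F} : nonres x = 1 ↔ ¬ IsSquare x := by
  rw [nonres]
  split_ifs with h <;> simp [h]

variable {F : Type*} [Field F] [Fintype F] {ω : F}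

lemma gen_ne_zero (hω : IsPrimitiveRoot ω (Fintype.card F - 1)) : ω ≠ 0 := by
  have h1 : 1 < Fintype.card F := Fintype.one_lt_card
  exact hω.ne_zero (by omega)

lemma exists_gen_pow_eq (hω : IsPrimitiveRoot ω (Fintype.card F - 1)) {x : F} (hx : x ≠ 0) :
    ∃ i < Fintype.card F - 1, ω ^ i = x := by
  have h1 : 1 < Fintype.card F := Fintype.one_lt_card
  have : NeZero (Fintype.card F - 1) := ⟨by omega⟩
  exact hω.eq_pow_of_pow_eq_one (FiniteField.pow_card_sub_one_eq_one x hx)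

/-- A sum over the nonzero elements as a sum over the powers of a primitive element. -/
lemma sum_gen_pow (hω : IsPrimitiveRoot ω (Fintype.card F - 1)) {M : Type*} [AddCommMonoid M]
    (f : F → M) (hf : f 0 = 0) :
    ∑ j ∈ Finset.range (Fintype.card F - 1), f (ω ^ j) = ∑ x, f x := by
  classical
  rw [← Finset.sum_erase Finset.univ hf]
  refine Finset.sum_bij (fun j _ => ω ^ j) ?_ ?_ ?_ (fun _ _ => rfl)
  · exact fun j _ => Finset.mem_erase.2 ⟨pow_ne_zero _ (gen_ne_zero hω), Finset.mem_univ _⟩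
  · exact fun i hi j hj h => hω.pow_inj (Finset.mem_range.1 hi) (Finset.mem_range.1 hj) h
  · intro x hx
    obtain ⟨i, hi, rfl⟩ := exists_gen_pow_eq hω (Finset.mem_erase.1 hx).1
    exact ⟨i, Finset.mem_range.2 hi, rfl⟩

/-- The group of units has even order, so the parity of a discrete logarithm is well defined and
detects squares. -/
lemma nonres_gen_pow (hω : IsPrimitiveRoot ω (Fintype.card F - 1)) (hodd : Odd (Fintype.card F))
    (j : ℕ) : nonres (ω ^ j) = j := by
  rcases Nat.even_or_odd j with hj | hj
  · rw [nonres, if_pos (hj.isSquare_pow ω), eq_comm, ZMod.natCast_eq_zero_iff]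
    exact hj.two_dvd
  · rw [(ZMod.natCast_eq_one_iff_odd).2 hj, nonres_eq_one_iff]
    rintro ⟨x, hx⟩
    have hx0 : x ≠ 0 := by
      rintro rfl
      exact pow_ne_zero j (gen_ne_zero hω) (by simpa using hx)
    obtain ⟨i, -, rfl⟩ := exists_gen_pow_eq hω hx0
    have h1 : 1 < Fintype.card F := Fintype.one_lt_card
    rw [← pow_add, (hω.isOfFinOrder (by omega)).pow_eq_pow_iff_modEq, ← hω.eq_orderOf] at hx
    have h2 : j ≡ i + i [MOD 2] := hx.of_dvd (by
      obtain ⟨c, hc⟩ := hodd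
      exact ⟨c, by omega⟩)
    have h3 := Nat.odd_iff.1 hj
    have h4 : j % 2 = (i + i) % 2 := h2
    omega

lemma nonres_mul (hω : IsPrimitiveRoot ω (Fintype.card F - 1)) (hodd : Odd (Fintype.card F))
    {x y : F} (hx : x ≠ 0) (hy : y ≠ 0) : nonres (x * y) = nonres x + nonres y := by
  obtain ⟨i, -, rfl⟩ := exists_gen_pow_eq hω hx
  obtain ⟨j, -, rfl⟩ := exists_gen_pow_eq hω hy
  rw [← pow_add]
  simp only [nonres_gen_pow hω hodd, Nat.cast_add]

lemma nonres_prod (hω : IsPrimitiveRoot ω (Fintype.card F - 1)) (hodd : Odd (Fintype.card F))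
    {ι : Type*} (s : Finset ι) (f : ι → F) (hf : ∏ i ∈ s, f i ≠ 0) :
    nonres (∏ i ∈ s, f i) = ∑ i ∈ s, nonres (f i) := by
  classical
  induction s using Finset.induction_on with
  | empty => simp [nonres]
  | insert a s ha ih =>
    rw [Finset.prod_insert ha] at hf
    rw [Finset.prod_insert ha, Finset.sum_insert ha,
      nonres_mul hω hodd (left_ne_zero_of_mul hf) (right_ne_zero_of_mul hf),
      ih (right_ne_zero_of_mul hf)]

lemma sum_range_two_mul_cast (n : ℕ) : ∑ j ∈ Finset.range (2 * n), (j : ZMod 2) = n := by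
  induction n with
  | zero => simp
  | succ n ih =>
    rw [Nat.mul_succ, Finset.sum_range_succ, Finset.sum_range_succ, ih]
    push_cast
    have h2 : (2 : ZMod 2) = 0 := rfl
    linear_combination (2 * (n : ZMod 2)) * h2

lemma sum_nonres (hω : IsPrimitiveRoot ω (Fintype.card F - 1)) {n : ℕ}
    (hn : Fintype.card F = 2 * n + 1) : ∑ x : F, nonres x = n := by
  rw [← sum_gen_pow hω nonres (by simp [nonres]), ← sum_range_two_mul_cast]
  rw [hn, Nat.add_sub_cancel]
  exact Finset.sum_congr rfl fun j _ => nonres_gen_pow hω ⟨n, hn⟩ j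

lemma sum_nonres_add [DecidableEq F] (hω : IsPrimitiveRoot ω (Fintype.card F - 1)) {n : ℕ}
    (hn : Fintype.card F = 2 * n + 1) (A : F) :
    ∑ x ∈ Finset.univ.erase (0 : F), nonres (x + A) = n - nonres A := by
  rw [← sum_nonres hω hn, ← Equiv.sum_comp (Equiv.addRight A) nonres,
    ← Finset.sum_erase_add _ _ (Finset.mem_univ (0 : F))]
  simp

end Nonresidues

/-! ### Multiplicative characters in characteristic 2 and the trace -/

section Characters

variable {K : Type*} [Field K]

lemma exists_mulChar {F : Type*} [Field F] [Fintype F] {ω : F}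
    (hω : IsPrimitiveRoot ω (Fintype.card F - 1)) {α : K}
    (hα : α ^ (Fintype.card F - 1) = 1) :
    ∃ χ : MulChar F K, χ ω = α := by
  classical
  have h1 : 1 < Fintype.card F := Fintype.one_lt_card
  have hα0 : α ≠ 0 := by
    rintro rfl
    rw [zero_pow (by omega)] at hα
    exact zero_ne_one hα
  have hmem : Units.mk0 α hα0 ∈ rootsOfUnity (Fintype.card Fˣ) K := by
    rw [mem_rootsOfUnity, Fintype.card_units]
    ext
    simpa using hα
  have hgen : ∀ x, x ∈ Subgroup.zpowers (Units.mk0 ω (gen_ne_zero hω)) := by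
    intro x
    obtain ⟨i, -, hi⟩ := exists_gen_pow_eq hω x.ne_zero
    refine ⟨i, ?_⟩
    ext
    simpa using hi
  refine ⟨MulChar.ofRootOfUnity hmem hgen, ?_⟩
  exact MulChar.ofRootOfUnity_spec hmem hgen

lemma trace_algebraMap_mul {p : ℕ} [Fact p.Prime] {F : Type*} [Field F] [Algebra (ZMod p) F]
    (c : ZMod p) (z : F) :
    Algebra.trace (ZMod p) F (algebraMap (ZMod p) F c * z) = c * Algebra.trace (ZMod p) F z := by
  rw [← Algebra.smul_def, map_smul, smul_eq_mul]

variable {p : ℕ} [Fact p.Prime] {F : Type*} [Field F] [Fintype F] [Algebra (ZMod p) F]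

open Classical in
/-- Decomposition of a sum over `F` along the values of the trace. -/
lemma sum_eq_sum_trace {M : Type*} [AddCommMonoid M] (f : F → M) :
    ∑ y, f y = ∑ y with Algebra.trace (ZMod p) F y = 0, f y +
      ∑ c ∈ Finset.univ.erase (0 : ZMod p), ∑ z with Algebra.trace (ZMod p) F z = 1,
        f (algebraMap (ZMod p) F c * z) := by
  rw [← Finset.sum_fiberwise Finset.univ (fun y => Algebra.trace (ZMod p) F y) f,
    ← Finset.add_sum_erase _ _ (Finset.mem_univ (0 : ZMod p))]
  congr 1
  refine Finset.sum_congr rfl fun c hc => ?_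
  have hc0 : c ≠ 0 := (Finset.mem_erase.1 hc).1
  have hc1 : algebraMap (ZMod p) F c ≠ 0 := by simpa using hc0
  symm
  refine Finset.sum_bij (fun z _ => algebraMap (ZMod p) F c * z) ?_ ?_ ?_ (fun _ _ => rfl)
  · intro z hz
    simp only [Finset.mem_filter, Finset.mem_univ, true_and] at hz ⊢
    rw [trace_algebraMap_mul, hz, mul_one]
  · exact fun a _ b _ h => mul_left_cancel₀ hc1 h
  · intro y hy
    simp only [Finset.mem_filter, Finset.mem_univ, true_and] at hy
    have hyz : algebraMap (ZMod p) F c * ((algebraMap (ZMod p) F c)⁻¹ * y) = y := by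
      rw [mul_inv_cancel_left₀ hc1]
    refine ⟨(algebraMap (ZMod p) F c)⁻¹ * y, ?_, hyz⟩
    simp only [Finset.mem_filter, Finset.mem_univ, true_and]
    have := trace_algebraMap_mul c ((algebraMap (ZMod p) F c)⁻¹ * y)
    rw [hyz, hy] at this
    exact mul_left_cancel₀ hc0 (by rw [← this, mul_one])

variable [CharP K 2]

open Classical in
/-- In characteristic `2` a multiplicative character sums to zero over the trace-zero elements. -/
lemma sum_trace_zero (hodd : Odd (Fintype.card F)) (χ : MulChar F K) :
    ∑ y with Algebra.trace (ZMod p) F y = 0, χ y = 0 := by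
  -- The square of χ(-1) is 1, and 1 is the only square root of 1 in characteristic 2; hence y and
  -- -y cancel.
  have hneg : χ (-1) = 1 := by
    have h : (χ (-1)) ^ 2 = 1 := by rw [← map_pow]; simp
    rw [← sub_eq_zero] at h ⊢
    rw [← pow_eq_zero_iff (two_ne_zero), CharTwo.sub_eq_add, CharTwo.add_sq, ← h]
    simp [CharTwo.sub_eq_add]
  refine Finset.sum_involution (fun y _ => -y) ?_ ?_ ?_ ?_
  · intro y _
    rw [neg_eq_neg_one_mul, map_mul, hneg, one_mul, CharTwo.add_self_eq_zero]
  · intro y _ hy h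
    have hy0 : y = 0 := by
      refine (Ring.eq_self_iff_eq_zero_of_char_ne_two ?_).1 h
      intro hF
      exact (Nat.not_even_iff_odd.2 hodd) (Nat.even_iff.2 (FiniteField.even_card_of_char_two hF))
    exact hy (by rw [hy0, MulChar.map_zero])
  · intro y hy
    simpa using hy
  · intro y _
    simp

variable [IsAlgClosed K]

open Classical in
/-- The sum of a multiplicative character over the elements of trace `1` is nonzero. -/
lemma sum_trace_one_ne_zero (hodd : Odd (Fintype.card F)) (hp : p ≠ 2) (χ : MulChar F K) :
    ∑ z with Algebra.trace (ZMod p) F z = 1, χ z ≠ 0 := by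
  intro hC
  have hpK : (p : K) ≠ 0 := by
    rw [Ne, CharP.cast_eq_zero_iff K 2]
    exact fun h => hp ((Nat.prime_dvd_prime_iff_eq Nat.prime_two Fact.out).1 h).symm
  have : NeZero (p : K) := ⟨hpK⟩
  obtain ⟨ζ, hζ⟩ := HasEnoughRootsOfUnity.exists_primitiveRoot K p
  set ψ₀ : AddChar (ZMod p) K := AddChar.zmodChar p hζ.pow_eq_one with hψ₀
  set ψ : AddChar F K := ψ₀.compAddMonoidHom (Algebra.trace (ZMod p) F).toAddMonoidHom with hψ
  have hψy : ∀ y, ψ y = ψ₀ (Algebra.trace (ZMod p) F y) := fun y => rfl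
  -- The slice of trace c ≠ 0 is χ(c) ψ₀(c) times the trace-one sum; on the slice of trace 0 the
  -- additive character is trivial.
  have hgauss : gaussSum χ ψ = 0 := by
    rw [gaussSum, sum_eq_sum_trace (p := p)]
    have h0 : ∑ y with Algebra.trace (ZMod p) F y = 0, χ y * ψ y = 0 := by
      rw [← sum_trace_zero (p := p) hodd χ]
      refine Finset.sum_congr rfl fun y hy => ?_
      rw [hψy, (Finset.mem_filter.1 hy).2, AddChar.map_zero_eq_one, mul_one]
    rw [h0, zero_add]
    refine Finset.sum_eq_zero fun c _ => ?_
    rw [← mul_zero (χ (algebraMap (ZMod p) F c) * ψ₀ c), ← hC, Finset.mul_sum]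
    refine Finset.sum_congr rfl fun z hz => ?_
    rw [hψy, trace_algebraMap_mul, (Finset.mem_filter.1 hz).2, mul_one, map_mul]
    ring
  have hψ1 : ψ ≠ 1 := by
    intro h
    obtain ⟨y, hy⟩ := Algebra.trace_surjective (ZMod p) F 1
    have h1 : ψ y = 1 := by rw [h]; rfl
    rw [hψy, hy, hψ₀, AddChar.zmodChar_apply, ZMod.val_one, pow_one] at h1
    exact hζ.ne_one (Fact.out : p.Prime).one_lt h1
  by_cases hχ : χ = 1
  · rw [hχ, gaussSum_one_left hψ1] at hgauss
    exact one_ne_zero (neg_eq_zero.1 hgauss)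
  · refine gaussSum_ne_zero_of_nontrivial ?_ hχ (AddChar.IsPrimitive.of_ne_one hψ1) hgauss
    rw [Ne, CharP.cast_eq_zero_iff K 2, ← even_iff_two_dvd, Nat.not_even_iff_odd]
    exact hodd

end Characters

lemma sum_range_mul_eq {M : Type*} [AddCommMonoid M] (f : ℕ → M) (r n : ℕ) :
    ∑ k ∈ Finset.range (r * n), f k =
      ∑ j ∈ Finset.range r, ∑ l ∈ Finset.range n, f (j + r * l) := by
  induction n with
  | zero => simp
  | succ n ih =>
    rw [Nat.mul_succ, Finset.sum_range_add, ih, ← Finset.sum_add_distrib]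
    refine Finset.sum_congr rfl fun j _ => ?_
    rw [Finset.sum_range_succ, add_comm j]

/-! ### Linear relations between r-th roots of unity over 𝔽₂ -/

section Cyclotomic

variable {r : ℕ}

/-- The order of 2 modulo r is the degree of every irreducible factor, and here it equals φ(r). -/
lemma irreducible_cyclotomic_two (hr : r.Prime) (hr_odd : Odd r)
    (h2 : orderOf (2 : ZMod r) = r - 1) : Irreducible (cyclotomic r (ZMod 2)) := by
  have h : ¬ 2 ∣ r := fun h => (Nat.not_even_iff_odd.2 hr_odd) (even_iff_two_dvd.2 h)
  refine ZMod.irreducible_of_dvd_cyclotomic_of_natDegree h dvd_rfl ?_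
  rw [natDegree_cyclotomic, Nat.totient_prime hr, ← orderOf_units, ZMod.coe_unitOfCoprime,
    ← h2, Nat.cast_ofNat]

/-- If `2` is a primitive root modulo `r`, the only linear relation over `𝔽₂` between the powers
`1, γ, …, γ ^ (r - 1)` of a nontrivial `r`-th root of unity is that their sum vanishes. -/
lemma coeff_eq_of_sum_eq_zero (hr : r.Prime) (hr_odd : Odd r)
    (h2 : orderOf (2 : ZMod r) = r - 1) {K : Type*} [Field K] [Algebra (ZMod 2) K] {γ : K}
    (hγ : γ ^ r = 1) (hγ1 : γ ≠ 1) (b : ℕ → ZMod 2)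
    (hb : ∑ j ∈ Finset.range r, algebraMap (ZMod 2) K (b j) * γ ^ j = 0) {i j : ℕ} (hi : i < r)
    (hj : j < r) : b i = b j := by
  have : Fact r.Prime := ⟨hr⟩
  set f : (ZMod 2)[X] := ∑ j ∈ Finset.range r, C (b j) * X ^ j with hf
  have hcoeff : ∀ k < r, f.coeff k = b k := by
    intro k hk
    rw [hf, finsetSum_coeff]
    simp [coeff_C_mul, coeff_X_pow, hk]
  have hf0 : aeval γ f = 0 := by simpa [hf] using hb
  have hcyc : (cyclotomic r (ZMod 2) : (ZMod 2)[X]) = ∑ i ∈ Finset.range r, X ^ i :=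
    cyclotomic_prime (ZMod 2) r
  have hc0 : aeval γ (cyclotomic r (ZMod 2)) = 0 := by
    rw [hcyc, map_sum]
    simp only [map_pow, aeval_X]
    have := geom_sum_mul γ r
    rw [hγ, sub_self] at this
    exact (mul_eq_zero.1 this).resolve_right (sub_ne_zero.2 hγ1)
  obtain ⟨q, hq⟩ : cyclotomic r (ZMod 2) ∣ f := by
    by_contra h
    exact not_both_roots ((irreducible_cyclotomic_two hr hr_odd h2).coprime_iff_not_dvd.2 h) hc0 hf0
  have hfdeg : f.natDegree ≤ r - 1 := by
    refine natDegree_sum_le_of_forall_le _ _ fun j hj => ?_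
    refine (natDegree_C_mul_X_pow_le _ _).trans ?_
    have := Finset.mem_range.1 hj
    omega
  -- The cyclotomic polynomial already has degree r - 1, so the quotient is a constant.
  have hqdeg : q.natDegree = 0 := by
    by_cases hq0 : q = 0
    · simp [hq0]
    have h3 := hfdeg
    rw [hq, natDegree_mul (cyclotomic_ne_zero _ _) hq0, natDegree_cyclotomic,
      Nat.totient_prime hr] at h3
    omega
  have hall : ∀ k < r, b k = q.coeff 0 := by
    intro k hk
    rw [← hcoeff k hk, hq, eq_C_of_natDegree_eq_zero hqdeg, coeff_mul_C, hcyc, finsetSum_coeff]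
    simp [coeff_X_pow, hk]
  rw [hall i hi, hall j hj]

end Cyclotomic

/-! ### Character sums over the prime field -/

section PrimeField

variable {p : ℕ} [Fact p.Prime] {g : ZMod p}

/-- The clique bound: if all differences of distinct `n`-th powers of nonzero residues
have the same quadratic character, where `p = r n + 1`, then `r ^ 2 ≤ p`. -/
lemma sq_le_of_nonres_pow_sub_pow (hg : IsPrimitiveRoot g (p - 1)) (hp : Odd p) {r n : ℕ}
    (hrn : p = r * n + 1) {c₀ : ZMod 2}
    (h : ∀ x y : ZMod p, x ≠ 0 → y ≠ 0 → x ^ n ≠ y ^ n → nonres (x ^ n - y ^ n) = c₀) :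
    r ^ 2 ≤ p := by
  have hg' : IsPrimitiveRoot g (Fintype.card (ZMod p) - 1) := by rwa [ZMod.card]
  have hodd : Odd (Fintype.card (ZMod p)) := by rwa [ZMod.card]
  have hg0 : g ≠ 0 := gen_ne_zero hg'
  have hgn : nonres g = 1 := by simpa using nonres_gen_pow hg' hodd 1
  have hp1 : p - 1 = n * r := by
    rw [hrn, Nat.add_sub_cancel, mul_comm]
  have hpr : IsPrimitiveRoot (g ^ n) r := by
    refine hg.pow ?_ hp1
    have := (Fact.out : p.Prime).one_lt
    omega
  have hpow : ∀ i j, i < r → j < r → (g ^ i) ^ n = (g ^ j) ^ n → i = j := by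
    intro i j hi hj hij
    refine hpr.pow_inj hi hj ?_
    rw [← pow_mul, ← pow_mul, mul_comm n, mul_comm n, pow_mul, pow_mul, hij]
  -- For n-th powers, u + g v = u' + g v' gives u - u' = g (v' - v). If v ≠ v', both differences
  -- have character c₀, but g is a nonresidue.
  have hinj : Function.Injective fun x : Fin r × Fin r =>
      (g ^ (x.1 : ℕ)) ^ n + g * (g ^ (x.2 : ℕ)) ^ n := by
    rintro ⟨i, j⟩ ⟨i', j'⟩ hx
    simp only at hx
    have hj : j = j' := by
      by_contra hj
      have hj1 : (g ^ (j' : ℕ)) ^ n ≠ (g ^ (j : ℕ)) ^ n := fun h1 =>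
        hj (Fin.ext (hpow _ _ j.2 j'.2 h1.symm))
      have h1 : (g ^ (i : ℕ)) ^ n - (g ^ (i' : ℕ)) ^ n =
          g * ((g ^ (j' : ℕ)) ^ n - (g ^ (j : ℕ)) ^ n) := by
        linear_combination hx
      have hi1 : (g ^ (i : ℕ)) ^ n ≠ (g ^ (i' : ℕ)) ^ n := by
        intro h2
        rw [h2, sub_self] at h1
        exact mul_ne_zero hg0 (sub_ne_zero.2 hj1) h1.symm
      have h2 := congr_arg nonres h1
      rw [nonres_mul hg' hodd hg0 (sub_ne_zero.2 hj1), hgn,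
        h _ _ (pow_ne_zero _ hg0) (pow_ne_zero _ hg0) hj1,
        h _ _ (pow_ne_zero _ hg0) (pow_ne_zero _ hg0) hi1] at h2
      revert h2
      generalize c₀ = c
      revert c
      decide
    subst hj
    have hi : i = i' := Fin.ext (hpow _ _ i.2 i'.2 (add_right_cancel hx))
    rw [hi]
  have := Fintype.card_le_of_injective _ hinj
  rwa [Fintype.card_prod, Fintype.card_fin, ZMod.card, ← sq] at this

/-- A twisted sum of the sequence `k ↦ nonres (g ^ k + A)` does not vanish. -/
lemma sum_nonres_mul_pow_ne_zero (hg : IsPrimitiveRoot g (p - 1)) (hp : Odd p) {r n : ℕ}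
    (hr : r.Prime) (hr_odd : Odd r) (h2 : orderOf (2 : ZMod r) = r - 1) (hn : Even n)
    (hrn : p = r * n + 1) (hpr : p < r ^ 2) {A : ZMod p} (hA : A ≠ 0)
    {K : Type*} [Field K] [Algebra (ZMod 2) K] {γ : K} (hγ : γ ^ r = 1) (hγ1 : γ ≠ 1) :
    ∑ k ∈ Finset.range (p - 1), algebraMap (ZMod 2) K (nonres (g ^ k + A)) * γ ^ k ≠ 0 := by
  intro h0
  have hg' : IsPrimitiveRoot g (Fintype.card (ZMod p) - 1) := by rwa [ZMod.card]
  have hodd : Odd (Fintype.card (ZMod p)) := by rwa [ZMod.card]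
  have hp1 : p - 1 = r * n := by omega
  have hp0 : 0 < p - 1 := by
    have := (Fact.out : p.Prime).one_lt
    omega
  have hn0 : 0 < n := Nat.pos_of_ne_zero fun h => by simp [h] at hp1; omega
  -- Exponents are grouped modulo r, since γ^r = 1.
  set b : ℕ → ZMod 2 := fun j => ∑ l ∈ Finset.range n, nonres (g ^ (j + r * l) + A) with hb
  have hsum : ∑ j ∈ Finset.range r, algebraMap (ZMod 2) K (b j) * γ ^ j = 0 := by
    rw [← h0, hp1, sum_range_mul_eq]
    refine Finset.sum_congr rfl fun j _ => ?_
    rw [hb, map_sum, Finset.sum_mul]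
    refine Finset.sum_congr rfl fun l _ => ?_
    rw [pow_add γ, pow_mul γ, hγ, one_pow, mul_one]
  have hζ : IsPrimitiveRoot (g ^ r) n := hg.pow hp0 hp1
  -- The g^(j + r l) are the roots of X^n - g^(j n), evaluated at -A; n is even, so the signs
  -- disappear.
  have hprod : ∀ j, ∏ l ∈ Finset.range n, (g ^ (j + r * l) + A) = A ^ n - (g ^ j) ^ n := by
    intro j
    have h1 := congr_arg (eval (-A)) (X_pow_sub_C_eq_prod hζ hn0 (α := g ^ j) rfl)
    rw [eval_prod] at h1
    simp only [eval_sub, eval_pow, eval_X, eval_C, hn.neg_pow] at h1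
    rw [h1, ← one_mul (∏ l ∈ Finset.range n, (g ^ (j + r * l) + A)), ← hn.neg_one_pow]
    conv_lhs =>
      rw [← Finset.card_range n, ← Finset.prod_const, Finset.card_range,
        ← Finset.prod_mul_distrib]
    refine Finset.prod_congr rfl fun l _ => ?_
    rw [pow_add, pow_mul]
    ring
  have hconst : ∀ d : ZMod p, d ≠ 0 → A ^ n ≠ d ^ n → nonres (A ^ n - d ^ n) = b 0 := by
    intro d hd hAd
    obtain ⟨k, -, rfl⟩ := exists_gen_pow_eq hg' hd
    have hk : (g ^ k) ^ n = (g ^ (k % r)) ^ n := by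
      conv_lhs => rw [← Nat.mod_add_div k r]
      rw [pow_add, mul_pow, ← pow_mul g (r * _), mul_right_comm, pow_mul g (r * n), ← hp1,
        hg.pow_eq_one, one_pow, mul_one]
    rw [hk] at hAd ⊢
    rw [coeff_eq_of_sum_eq_zero hr hr_odd h2 hγ hγ1 b hsum hr.pos (Nat.mod_lt k hr.pos),
      ← hprod, nonres_prod hg' hodd]
    rw [hprod]
    exact sub_ne_zero.2 hAd
  refine absurd (sq_le_of_nonres_pow_sub_pow hg hp hrn (c₀ := b 0) ?_) (not_le.2 hpr)
  intro x y hx hy hxy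
  -- Scaling a pair (x, y) to (A, A y / x) multiplies the difference by an n-th power, a square
  -- because n is even.
  have hAx : A / x ≠ 0 := div_ne_zero hA hx
  have h1 : A ^ n - (A / x * y) ^ n = (A / x) ^ n * (x ^ n - y ^ n) := by
    rw [mul_sub, ← mul_pow, ← mul_pow, div_mul_cancel₀ _ hx]
  have h3 : A ^ n - (A / x * y) ^ n ≠ 0 := by
    rw [h1]
    exact mul_ne_zero (pow_ne_zero _ hAx) (sub_ne_zero.2 hxy)
  have h4 := hconst (A / x * y) (mul_ne_zero hAx hy) (sub_ne_zero.1 h3)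
  rw [h1, nonres_mul hg' hodd (pow_ne_zero _ hAx) (sub_ne_zero.2 hxy)] at h4
  rwa [nonres, if_pos (hn.isSquare_pow _), zero_add] at h4

/-- Substituting c = -A x turns the sum into η(-1) J(η, η), and J(η, η) = -η(-1). -/
lemma sum_quadraticChar_mul_add (hp : Odd p) {A : ZMod p} (hA : A ≠ 0) :
    ∑ c : ZMod p, quadraticChar (ZMod p) c * quadraticChar (ZMod p) (c + A) = -1 := by
  have hF : ringChar (ZMod p) ≠ 2 := by
    rw [ZMod.ringChar_zmod_n]
    rintro rfl
    exact absurd hp (by decide)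
  have hJ := jacobiSum_nontrivial_inv (quadraticChar_ne_one hF)
  rw [(quadraticChar_isQuadratic (ZMod p)).inv, jacobiSum] at hJ
  have hA' : -A ≠ 0 := neg_ne_zero.2 hA
  rw [← Equiv.sum_comp (Equiv.mulLeft₀ (-A) hA')]
  have h1 : ∀ x : ZMod p, quadraticChar (ZMod p) (-A * x) * quadraticChar (ZMod p) (-A * x + A) =
      quadraticChar (ZMod p) (-1) *
        (quadraticChar (ZMod p) x * quadraticChar (ZMod p) (1 - x)) := by
    intro x
    rw [← map_mul, show -A * x * (-A * x + A) = A ^ 2 * (-1 * (x * (1 - x))) by ring, map_mul,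
      quadraticChar_sq_one' hA, one_mul, map_mul, map_mul]
  refine (Finset.sum_congr rfl fun x _ => h1 x).trans ?_
  rw [← Finset.mul_sum, hJ, mul_neg, ← sq, quadraticChar_sq_one (by simp)]

lemma nonres_cast_eq {x : ZMod p} (hx : x ≠ 0) :
    (((if quadraticChar (ZMod p) x = -1 then 1 else 0 : ℤ)) : ZMod 2) = nonres x ∧
    1 - quadraticChar (ZMod p) x = 2 * (if quadraticChar (ZMod p) x = -1 then 1 else 0) := by
  constructor
  · rw [nonres]
    by_cases h : IsSquare x
    · have h1 : quadraticChar (ZMod p) x ≠ -1 := fun h2 =>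
        quadraticChar_neg_one_iff_not_isSquare.1 h2 h
      rw [if_neg h1, if_pos h, Int.cast_zero]
    · rw [if_pos (quadraticChar_neg_one_iff_not_isSquare.2 h), if_neg h, Int.cast_one]
  · rcases quadraticChar_dichotomy hx with h | h <;> rw [h] <;> norm_num

/-- The parity of the number of pairs of nonresidues with nonresidue difference `A`. -/
lemma sum_nonres_mul_nonres (hp : p % 8 = 7) {A : ZMod p} (hA : quadraticChar (ZMod p) A = -1) :
    ∑ c : ZMod p, nonres c * nonres (c + A) = 1 := by
  have hodd : Odd p := Nat.odd_iff.2 (by omega)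
  have hA0 : A ≠ 0 := by
    rintro rfl
    simp at hA
  have hF : ringChar (ZMod p) ≠ 2 := by
    rw [ZMod.ringChar_zmod_n]
    omega
  have hneg : quadraticChar (ZMod p) (-A) = 1 := by
    have h1 : quadraticChar (ZMod p) (-1) = -1 := by
      rw [quadraticChar_neg_one_iff_not_isSquare, FiniteField.isSquare_neg_one_iff, ZMod.card]
      omega
    rw [neg_eq_neg_one_mul, map_mul, h1, hA]
    norm_num
  have hA2 : -A ≠ 0 := neg_ne_zero.2 hA0
  set η := quadraticChar (ZMod p) with hη
  have hη0 : η 0 = 0 := MulChar.map_zero _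
  set ι : ZMod p → ℤ := fun x => if η x = -1 then 1 else 0 with hι
  have htotal : ∑ c : ZMod p, (1 - η c) * (1 - η (c + A)) = p - 1 := by
    have h1 : ∀ c, (1 - η c) * (1 - η (c + A)) = 1 - η c - η (c + A) + η c * η (c + A) :=
      fun c => by ring
    simp only [h1, Finset.sum_add_distrib, Finset.sum_sub_distrib]
    rw [sum_quadraticChar_mul_add hodd hA0, quadraticChar_sum_zero hF,
      show ∑ c : ZMod p, η (c + A) = ∑ c, η c from Equiv.sum_comp (Equiv.addRight A) η,
      quadraticChar_sum_zero hF]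
    simp [ZMod.card]
    ring
  -- The term at c = 0 is 1 - η(A) = 2, and the one at c = -A vanishes since η(-A) = 1.
  have hterm : ∀ c : ZMod p, (1 - η c) * (1 - η (c + A)) =
      4 * (ι c * ι (c + A)) + if c = 0 then 2 else 0 := by
    intro c
    by_cases hc : c = 0
    · subst hc
      simp [hι, hA, hη0]
    · rw [if_neg hc, (nonres_cast_eq hc).2]
      by_cases hcA : c + A = 0
      · have hc2 : c = -A := eq_neg_of_add_eq_zero_left hcA
        subst hc2
        rw [neg_add_cancel, hneg]
        simp [hι, hη0, hneg]
      · rw [(nonres_cast_eq hcA).2]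
        simp only [hι]
        ring
  simp only [hterm, Finset.sum_add_distrib, ← Finset.mul_sum] at htotal
  rw [Finset.sum_ite_eq' Finset.univ (0 : ZMod p), if_pos (Finset.mem_univ _)] at htotal
  have hcast : ((∑ c : ZMod p, ι c * ι (c + A) : ℤ) : ZMod 2) =
      ∑ c : ZMod p, nonres c * nonres (c + A) := by
    rw [Int.cast_sum]
    refine Finset.sum_congr rfl fun c _ => ?_
    rw [Int.cast_mul]
    have h : ∀ x : ZMod p, ((ι x : ℤ) : ZMod 2) = nonres x := by
      intro x
      by_cases hx : x = 0
      · subst hx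
        simp [hι, nonres, hη0]
      · exact (nonres_cast_eq hx).1
    rw [h, h]
  -- The number of pairs is (p - 3)/4, which is odd for p ≡ 7 modulo 8.
  rw [← hcast, ZMod.intCast_eq_one_iff_odd, Int.odd_iff]
  omega

end PrimeField

-- The terms j and j + h add up to h α^j = α^j, which leaves a geometric sum.
open Classical in
lemma sum_range_two_mul_cast_mul_pow {K : Type*} [Field K] [CharP K 2] {h : ℕ} (hh : Odd h)
    {α : K} (hα : α ^ h = 1) :
    ∑ j ∈ Finset.range (2 * h), (j : K) * α ^ j = if α = 1 then 1 else 0 := by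
  have hh1 : (h : K) = 1 := by
    obtain ⟨c, rfl⟩ := hh
    push_cast
    rw [CharTwo.two_eq_zero, zero_mul, zero_add]
  have h1 : ∑ j ∈ Finset.range (2 * h), (j : K) * α ^ j = ∑ j ∈ Finset.range h, α ^ j := by
    rw [two_mul, Finset.sum_range_add, ← Finset.sum_add_distrib]
    refine Finset.sum_congr rfl fun j _ => ?_
    rw [pow_add, hα]
    push_cast
    rw [hh1]
    linear_combination (j : K) * α ^ j * (CharTwo.two_eq_zero : (2 : K) = 0)
  rw [h1]
  split_ifs with hα1
  · simp [hα1, hh1]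
  · have := geom_sum_mul α h
    rw [hα, sub_self] at this
    exact (mul_eq_zero.1 this).resolve_right (sub_ne_zero.2 hα1)

/-! ### Values of the generating polynomial and its derivative at roots of unity -/

section Evaluation

variable {K : Type*} [Field K] [Algebra (ZMod 2) K]

lemma aeval_revPoly {n : ℕ} {T : ℕ → ZMod 2} {α β : K} (hαβ : α * β = 1) (hα : α ^ n = 1) :
    aeval β (revPoly n T) =
      α * ∑ j ∈ Finset.range n, algebraMap (ZMod 2) K (T j) * α ^ j := by
  rw [revPoly, map_sum, Finset.mul_sum]
  refine Finset.sum_congr rfl fun j hj => ?_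
  have h1 : β ^ (n - 1 - j) = α ^ (j + 1) := by
    have h2 : α ^ (j + 1) * α ^ (n - 1 - j) = 1 := by
      rw [← pow_add, ← hα]
      congr 1
      have := Finset.mem_range.1 hj
      omega
    have h3 : α ^ (n - 1 - j) * β ^ (n - 1 - j) = 1 := by rw [← mul_pow, hαβ, one_pow]
    calc β ^ (n - 1 - j) = α ^ (j + 1) * α ^ (n - 1 - j) * β ^ (n - 1 - j) := by rw [h2, one_mul]
      _ = α ^ (j + 1) := by rw [mul_assoc, h3, mul_one]
  rw [map_mul, aeval_C, map_pow, aeval_X, h1]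
  ring

variable [CharP K 2]

lemma aeval_derivative_revPoly {n : ℕ} (hn : Even n) {T : ℕ → ZMod 2} {α β : K}
    (hαβ : α * β = 1) (hα : α ^ n = 1) :
    aeval β (derivative (revPoly n T)) =
      α ^ 2 * (∑ j ∈ Finset.range n, algebraMap (ZMod 2) K (T j) * α ^ j +
        ∑ j ∈ Finset.range n, (j : K) * (algebraMap (ZMod 2) K (T j) * α ^ j)) := by
  rw [revPoly, derivative_sum, map_sum, ← Finset.sum_add_distrib, Finset.mul_sum]
  refine Finset.sum_congr rfl fun j hj => ?_
  have hjn := Finset.mem_range.1 hj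
  have h2K : (2 : K) = 0 := CharTwo.two_eq_zero
  have hcast : ((n - 1 - j : ℕ) : K) = 1 + j := by
    have h1 : ((n - 1 - j : ℕ) : K) + (1 + j) = 0 := by
      have h2 : ((n - 1 - j + (1 + j) : ℕ) : K) = 0 := by
        rw [CharP.cast_eq_zero_iff K 2, show n - 1 - j + (1 + j) = n by omega]
        exact hn.two_dvd
      exact_mod_cast h2
    linear_combination h1 - (1 + (j : K)) * h2K
  rw [derivative_C_mul_X_pow, map_mul, aeval_C, map_mul, map_natCast, hcast, map_pow, aeval_X]
  -- For j = n - 1 the exponent is truncated, but the coefficient 1 + j is zero in K.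
  by_cases hj1 : n - 1 - j = 0
  · have h0 : (1 + j : K) = 0 := by rw [← hcast, hj1, Nat.cast_zero]
    linear_combination (algebraMap (ZMod 2) K (T j) * β ^ (n - 1 - j - 1) -
      α ^ 2 * algebraMap (ZMod 2) K (T j) * α ^ j) * h0
  · have h1 : β ^ (n - 1 - j - 1) = α ^ (j + 2) := by
      have h2 : α ^ (j + 2) * α ^ (n - 1 - j - 1) = 1 := by
        rw [← pow_add, ← hα]
        congr 1
        omega
      have h3 : α ^ (n - 1 - j - 1) * β ^ (n - 1 - j - 1) = 1 := by rw [← mul_pow, hαβ, one_pow]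
      calc β ^ (n - 1 - j - 1) = α ^ (j + 2) * α ^ (n - 1 - j - 1) * β ^ (n - 1 - j - 1) := by
            rw [h2, one_mul]
        _ = α ^ (j + 2) := by rw [mul_assoc, h3, mul_one]
    rw [h1]
    ring

end Evaluation

/-! ### The NTU sequence as a character sum over F -/

section Sequence

variable {p : ℕ} [Fact p.Prime] {g : ZMod p}

lemma rho_eq (hg : IsPrimitiveRoot g (p - 1)) (hp : Odd p) (A x : ZMod p) :
    rho p g A x = nonres (x + A) := by
  have hg' : IsPrimitiveRoot g (Fintype.card (ZMod p) - 1) := by rwa [ZMod.card]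
  have hodd : Odd (Fintype.card (ZMod p)) := by rwa [ZMod.card]
  have hiff : x + A ∈ cyclotomicClass p 2 g 1 ↔ ¬ IsSquare (x + A) := by
    constructor
    · rintro ⟨i, -, hi⟩
      rw [hi, ← pow_add, ← nonres_eq_one_iff, nonres_gen_pow hg' hodd,
        ZMod.natCast_eq_one_iff_odd]
      exact ⟨i, by ring⟩
    · intro h
      have h0 : x + A ≠ 0 := by
        intro h0
        rw [h0] at h
        exact h (IsSquare.zero)
      obtain ⟨k, hk, hkx⟩ := exists_gen_pow_eq hg' h0
      rw [ZMod.card] at hk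
      rw [← hkx, ← nonres_eq_one_iff, nonres_gen_pow hg' hodd, ZMod.natCast_eq_one_iff_odd] at h
      obtain ⟨i, rfl⟩ := h
      refine ⟨i, by omega, ?_⟩
      rw [← hkx]
      ring
  rw [rho, nonres]
  by_cases h : IsSquare (x + A)
  · rw [if_neg (by rw [hiff]; exact not_not.2 h), if_pos h]
  · rw [if_pos (hiff.2 h), if_neg h]

variable {F : Type*} [Field F] [Fintype F] [Algebra (ZMod p) F] {ω : F}
  {K : Type*} [Field K] [Algebra (ZMod 2) K] [CharP K 2]

-- Elements of nonzero trace are c z with Tr z = 1, where the summand splits as a function of c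
-- times χ(z); moreover χ(g^k) = α^(ν k).
open Classical in
lemma sum_ntuSeq_mul_pow (hg : IsPrimitiveRoot g (p - 1)) (hp : Odd p)
    (hω : IsPrimitiveRoot ω (Fintype.card F - 1)) (hodd : Odd (Fintype.card F)) {ν : ℕ}
    (hgω : algebraMap (ZMod p) F g = ω ^ ν) (A : ZMod p) {χ : MulChar F K} {α : K}
    (hχ : χ ω = α) :
    ∑ j ∈ Finset.range (Fintype.card F - 1), algebraMap (ZMod 2) K (ntuSeq p ω g A j) * α ^ j =
      (∑ k ∈ Finset.range (p - 1), algebraMap (ZMod 2) K (nonres (g ^ k + A)) * (α ^ ν) ^ k) *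
        ∑ z with Algebra.trace (ZMod p) F z = 1, χ z := by
  have hg' : IsPrimitiveRoot g (Fintype.card (ZMod p) - 1) := by rwa [ZMod.card]
  set f : F → K := fun y =>
    algebraMap (ZMod 2) K (nonres (Algebra.trace (ZMod p) F y + A)) * χ y with hf
  have h1 : ∀ j, algebraMap (ZMod 2) K (ntuSeq p ω g A j) * α ^ j = f (ω ^ j) := fun j => by
    rw [ntuSeq, rho_eq hg hp, mSeq]
    simp only [hf, map_pow, hχ]
  rw [Finset.sum_congr rfl fun j _ => h1 j, sum_gen_pow hω f (by simp [hf, MulChar.map_zero]),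
    sum_eq_sum_trace (p := p)]
  have h0 : ∑ y with Algebra.trace (ZMod p) F y = 0, f y = 0 := by
    rw [← mul_zero (algebraMap (ZMod 2) K (nonres A)), ← sum_trace_zero (p := p) hodd χ,
      Finset.mul_sum]
    refine Finset.sum_congr rfl fun y hy => ?_
    rw [hf]
    simp only
    rw [(Finset.mem_filter.1 hy).2, zero_add]
  set f' : ZMod p → K := fun c =>
    algebraMap (ZMod 2) K (nonres (c + A)) * χ (algebraMap (ZMod p) F c) with hf'
  have h2 : ∀ k, algebraMap (ZMod 2) K (nonres (g ^ k + A)) * (α ^ ν) ^ k = f' (g ^ k) :=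
    fun k => by
      rw [hf']
      simp only
      rw [map_pow, hgω, map_pow, map_pow, hχ]
  have hf'0 : f' 0 = 0 := by simp [hf', MulChar.map_zero]
  have h3 := sum_gen_pow hg' f' hf'0
  rw [ZMod.card] at h3
  rw [h0, zero_add, Finset.sum_congr rfl fun k _ => h2 k, h3,
    ← Finset.sum_erase Finset.univ hf'0, Finset.sum_mul]
  refine Finset.sum_congr rfl fun c _ => ?_
  rw [Finset.mul_sum]
  refine Finset.sum_congr rfl fun z hz => ?_
  rw [hf, hf']
  simp only
  rw [trace_algebraMap_mul, (Finset.mem_filter.1 hz).2, mul_one, map_mul, mul_assoc]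

-- The parity of j is `nonres (ω ^ j)`. As ν is odd, nonresidues of 𝔽_p stay nonsquares in F, and χ
-- is trivial on 𝔽_pˣ, so the weight at c z is additive in c and z.
open Classical in
lemma sum_mul_ntuSeq_mul_pow (hg : IsPrimitiveRoot g (p - 1)) (hp : p % 8 = 7)
    (hω : IsPrimitiveRoot ω (Fintype.card F - 1)) (hodd : Odd (Fintype.card F)) {ν : ℕ}
    (hν : Odd ν) (hgω : algebraMap (ZMod p) F g = ω ^ ν) {A : ZMod p}
    (hA : quadraticChar (ZMod p) A = -1) {χ : MulChar F K} {α : K} (hχ : χ ω = α)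
    (hα : α ^ ν = 1) :
    ∑ j ∈ Finset.range (Fintype.card F - 1),
        (j : K) * (algebraMap (ZMod 2) K (ntuSeq p ω g A j) * α ^ j) =
      ∑ j ∈ Finset.range (Fintype.card F - 1), (j : K) * α ^ j := by
  have hp2 : Odd p := Nat.odd_iff.2 (by omega)
  have hg' : IsPrimitiveRoot g (Fintype.card (ZMod p) - 1) := by rwa [ZMod.card]
  have hodd' : Odd (Fintype.card (ZMod p)) := by rwa [ZMod.card]
  set a := algebraMap (ZMod 2) K with ha
  have hj : ∀ j : ℕ, (j : K) = a (nonres (ω ^ j)) := fun j => by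
    rw [nonres_gen_pow hω hodd, map_natCast]
  have hmul : ∀ c : ZMod p, c ≠ 0 → ∀ z : F,
      a (nonres (algebraMap (ZMod p) F c * z)) * χ (algebraMap (ZMod p) F c * z) =
        a (nonres c) * χ z + a (nonres z) * χ z := by
    intro c hc z
    by_cases hz : z = 0
    · simp [hz, MulChar.map_zero]
    have hc1 : algebraMap (ZMod p) F c ≠ 0 := by simpa using hc
    obtain ⟨k, -, rfl⟩ := exists_gen_pow_eq hg' hc
    rw [nonres_mul hω hodd hc1 hz, map_mul, map_pow (algebraMap (ZMod p) F), hgω, map_pow χ,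
      map_pow χ, hχ, hα, one_pow, one_mul, ← pow_mul, nonres_gen_pow hω hodd,
      nonres_gen_pow hg' hodd', Nat.cast_mul, (ZMod.natCast_eq_one_iff_odd).2 hν, one_mul,
      map_add, add_mul]
  set t : F → ZMod p := fun y => Algebra.trace (ZMod p) F y with ht
  have hfst : ∀ j : ℕ, (j : K) * (a (ntuSeq p ω g A j) * α ^ j) =
      a (nonres (t (ω ^ j) + A)) * (a (nonres (ω ^ j)) * χ (ω ^ j)) := fun j => by
    rw [ntuSeq, rho_eq hg hp2, mSeq, map_pow χ, hχ, hj]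
    ring
  have hsnd : ∀ j : ℕ, (j : K) * α ^ j = a (nonres (ω ^ j)) * χ (ω ^ j) := fun j => by
    rw [map_pow χ, hχ, hj]
  rw [Finset.sum_congr rfl fun j _ => hfst j, Finset.sum_congr rfl fun j _ => hsnd j,
    sum_gen_pow hω (fun y => a (nonres (t y + A)) * (a (nonres y) * χ y)) (by simp [MulChar.map_zero]),
    sum_gen_pow hω (fun y => a (nonres y) * χ y) (by simp [MulChar.map_zero]),
    sum_eq_sum_trace (p := p), sum_eq_sum_trace (p := p) (fun y => a (nonres y) * χ y)]
  have hnA : nonres A = 1 := nonres_eq_one_iff.2 (quadraticChar_neg_one_iff_not_isSquare.1 hA)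
  have hcard : Fintype.card (ZMod p) = 2 * (p / 2) + 1 := by
    rw [ZMod.card]
    omega
  have hhalf : ((p / 2 : ℕ) : ZMod 2) = 1 := by
    rw [ZMod.natCast_eq_one_iff_odd, Nat.odd_iff]
    omega
  congr 1
  · refine Finset.sum_congr rfl fun y hy => ?_
    have hty : t y = 0 := (Finset.mem_filter.1 hy).2
    simp only [hty, zero_add, hnA, map_one, one_mul]
  · set C := ∑ z with Algebra.trace (ZMod p) F z = 1, χ z with hC
    set D := ∑ z with Algebra.trace (ZMod p) F z = 1, a (nonres z) * χ z with hD
    have h1 : ∀ c ∈ Finset.univ.erase (0 : ZMod p),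
        ∑ z with Algebra.trace (ZMod p) F z = 1, a (nonres (algebraMap (ZMod p) F c * z)) *
          χ (algebraMap (ZMod p) F c * z) = a (nonres c) * C + D := by
      intro c hc
      rw [Finset.sum_congr rfl fun z _ => hmul c (Finset.mem_erase.1 hc).1 z,
        Finset.sum_add_distrib, ← Finset.mul_sum]
    have h2 : ∀ c ∈ Finset.univ.erase (0 : ZMod p),
        ∑ z with Algebra.trace (ZMod p) F z = 1, a (nonres (t (algebraMap (ZMod p) F c * z) + A)) *
          (a (nonres (algebraMap (ZMod p) F c * z)) * χ (algebraMap (ZMod p) F c * z)) =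
        a (nonres c * nonres (c + A)) * C + a (nonres (c + A)) * D := by
      intro c hc
      rw [map_mul, mul_comm (a (nonres c)), mul_assoc, ← mul_add, ← h1 c hc, Finset.mul_sum]
      refine Finset.sum_congr rfl fun z hz => ?_
      rw [ht]
      simp only
      rw [trace_algebraMap_mul, (Finset.mem_filter.1 hz).2, mul_one]
    -- Left: C times the number of nonresidue pairs, plus ((p - 1)/2 - 1) D. Right: (p - 1)/2 · C +
    -- (p - 1) D. Both equal C modulo 2.
    rw [Finset.sum_congr rfl h1, Finset.sum_congr rfl h2, Finset.sum_add_distrib,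
      Finset.sum_add_distrib, ← Finset.sum_mul, ← Finset.sum_mul, ← Finset.sum_mul, ← map_sum,
      ← map_sum, ← map_sum, sum_nonres_add hg' hcard, hnA, hhalf, sub_self,
      Finset.sum_erase Finset.univ (by simp [nonres]), sum_nonres_mul_nonres hp hA,
      Finset.sum_erase Finset.univ (by simp [nonres]), sum_nonres hg' hcard, hhalf,
      Finset.sum_const, Finset.card_erase_of_mem (Finset.mem_univ _), Finset.card_univ, ZMod.card,
      map_zero, zero_mul, nsmul_eq_mul,
      (CharP.cast_eq_zero_iff K 2 (p - 1)).2 (by omega), zero_mul]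

end Sequence

/-! ### Zeros of the generating polynomial of T -/

section Main

variable {p : ℕ} [Fact p.Prime] {g A : ZMod p} {F : Type*} [Field F] [Fintype F]
  [Algebra (ZMod p) F] {ω : F}

lemma ntuSeq_periodic (hω : IsPrimitiveRoot ω (Fintype.card F - 1)) :
    Function.Periodic (ntuSeq p ω g A) (Fintype.card F - 1) := by
  intro n
  simp only [ntuSeq, mSeq, pow_add, hω.pow_eq_one, mul_one]

/-- The data of the sequence: `p = r n + 1` with `r` an odd prime for which `2` is a primitive
root, `F` a finite field of odd order with primitive element `ω`, and `g = ω ^ ν`. -/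
structure Setting (p : ℕ) [Fact p.Prime] {F : Type*} [Field F] [Fintype F] [Algebra (ZMod p) F]
    (ω : F) (g : ZMod p) (r s ν : ℕ) : Prop where
  odd_p : Odd p
  odd_card : Odd (Fintype.card F)
  prim_ω : IsPrimitiveRoot ω (Fintype.card F - 1)
  prim_g : IsPrimitiveRoot g (p - 1)
  map_g : algebraMap (ZMod p) F g = ω ^ ν
  card_sub_one : Fintype.card F - 1 = ν * (p - 1)
  prime_r : r.Prime
  odd_r : Odd r
  s_pos : 0 < s
  p_eq : p = r * 2 ^ s + 1
  orderOf_two : orderOf (2 : ZMod r) = r - 1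
  p_lt : p < r ^ 2

variable {r s ν : ℕ}

lemma Setting.exists_sum_eq (h : Setting p ω g r s ν) (A : ZMod p) {K : Type*} [Field K]
    [Algebra (ZMod 2) K] [CharP K 2] [IsAlgClosed K] {α : K}
    (hα : α ^ (Fintype.card F - 1) = 1) : ∃ C : K, C ≠ 0 ∧
      ∑ j ∈ Finset.range (Fintype.card F - 1), algebraMap (ZMod 2) K (ntuSeq p ω g A j) * α ^ j =
        (∑ k ∈ Finset.range (p - 1),
          algebraMap (ZMod 2) K (nonres (g ^ k + A)) * (α ^ ν) ^ k) * C := by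
  classical
  obtain ⟨χ, hχ⟩ := exists_mulChar h.prim_ω hα
  have hp2 : p ≠ 2 := by
    rintro rfl
    exact absurd h.odd_p (by decide)
  exact ⟨_, sum_trace_one_ne_zero (p := p) h.odd_card hp2 χ,
    sum_ntuSeq_mul_pow h.prim_g h.odd_p h.prim_ω h.odd_card h.map_g A hχ⟩

lemma Setting.sum_nonres_mul_pow_ne_zero (h : Setting p ω g r s ν) (hA : A ≠ 0) {K : Type*}
    [Field K] [Algebra (ZMod 2) K] [CharP K 2] {α : K} (hα : α ^ (Fintype.card F - 1) = 1)
    (hα1 : α ^ ν ≠ 1) :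
    ∑ k ∈ Finset.range (p - 1), algebraMap (ZMod 2) K (nonres (g ^ k + A)) * (α ^ ν) ^ k ≠ 0 := by
  refine NTU.sum_nonres_mul_pow_ne_zero h.prim_g h.odd_p h.prime_r h.odd_r h.orderOf_two
    ((Nat.even_pow).2 ⟨even_two, h.s_pos.ne'⟩) h.p_eq h.p_lt hA ?_ hα1
  have hp1 : p - 1 = r * 2 ^ s := by
    have := h.p_eq
    omega
  rw [h.card_sub_one, pow_mul, hp1, pow_mul] at hα
  -- Characteristic 2 removes the factor 2^s from the order of α^ν.
  have h1 : ((α ^ ν) ^ r - 1) ^ 2 ^ s = 0 := by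
    rw [sub_pow_char_pow, hα, one_pow, sub_self]
  exact sub_eq_zero.1 (pow_eq_zero_iff (by positivity) |>.1 h1)

lemma Setting.sum_nonres_mul_one_pow (h : Setting p ω g r s ν) {K : Type*} [Field K]
    [Algebra (ZMod 2) K] :
    ∑ k ∈ Finset.range (p - 1), algebraMap (ZMod 2) K (nonres (g ^ k + A)) * (1 : K) ^ k =
      algebraMap (ZMod 2) K ((r * 2 ^ (s - 1) : ℕ) - nonres A) := by
  have hg' : IsPrimitiveRoot g (Fintype.card (ZMod p) - 1) := by
    rw [ZMod.card]
    exact h.prim_g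
  have hcard : Fintype.card (ZMod p) = 2 * (r * 2 ^ (s - 1)) + 1 := by
    rw [ZMod.card]
    obtain ⟨t, rfl⟩ : ∃ t, s = t + 1 := ⟨s - 1, by have := h.s_pos; omega⟩
    conv_lhs => rw [h.p_eq]
    rw [Nat.add_sub_cancel]
    ring
  rw [← sum_nonres_add hg' hcard, map_sum]
  -- The value at 0 is forced to 0, as `sum_gen_pow` requires.
  set f : ZMod p → K := fun c => if c = 0 then 0 else algebraMap (ZMod 2) K (nonres (c + A))
  have hf0 : f 0 = 0 := if_pos rfl
  have h1 := sum_gen_pow hg' f hf0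
  rw [ZMod.card, ← Finset.sum_erase Finset.univ hf0] at h1
  refine Eq.trans (Finset.sum_congr rfl fun k _ => ?_)
    (h1.trans (Finset.sum_congr rfl fun c hc => if_neg (Finset.mem_erase.1 hc).1))
  rw [one_pow, mul_one]
  exact (if_neg (pow_ne_zero _ (gen_ne_zero hg'))).symm

/-- In the first case the generating polynomial has no common root with `X ^ N - 1`. -/
lemma Setting.aeval_revPoly_ne_zero (h : Setting p ω g r s ν) (hA : A ≠ 0)
    (hpar : ((r * 2 ^ (s - 1) : ℕ) : ZMod 2) - nonres A ≠ 0) {K : Type*} [Field K]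
    [Algebra (ZMod 2) K] [CharP K 2] [IsAlgClosed K] {β : K}
    (hβ : β ^ (Fintype.card F - 1) = 1) :
    aeval β (revPoly (Fintype.card F - 1) (ntuSeq p ω g A)) ≠ 0 := by
  have hN : 1 < Fintype.card F := Fintype.one_lt_card
  have hβ0 : β ≠ 0 := by
    rintro rfl
    rw [zero_pow (by omega)] at hβ
    exact zero_ne_one hβ
  have hα : β⁻¹ ^ (Fintype.card F - 1) = 1 := by rw [inv_pow, hβ, inv_one]
  obtain ⟨C, hC, hsum⟩ := h.exists_sum_eq A hα
  rw [aeval_revPoly (inv_mul_cancel₀ hβ0) hα, hsum]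
  refine mul_ne_zero (inv_ne_zero hβ0) (mul_ne_zero ?_ hC)
  by_cases hα1 : β⁻¹ ^ ν = 1
  · rw [hα1, h.sum_nonres_mul_one_pow]
    exact (_root_.map_ne_zero _).2 hpar
  · exact h.sum_nonres_mul_pow_ne_zero hA hα hα1

/-- In the second case the roots are the `ν`-th roots of unity. -/
lemma Setting.aeval_revPoly_eq_zero_iff (h : Setting p ω g r s ν) (hA : A ≠ 0)
    (hpar : ((r * 2 ^ (s - 1) : ℕ) : ZMod 2) - nonres A = 0) {K : Type*} [Field K]
    [Algebra (ZMod 2) K] [CharP K 2] [IsAlgClosed K] {β : K}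
    (hβ : β ^ (Fintype.card F - 1) = 1) :
    aeval β (revPoly (Fintype.card F - 1) (ntuSeq p ω g A)) = 0 ↔ β ^ ν = 1 := by
  have hN : 1 < Fintype.card F := Fintype.one_lt_card
  have hβ0 : β ≠ 0 := by
    rintro rfl
    rw [zero_pow (by omega)] at hβ
    exact zero_ne_one hβ
  have hα : β⁻¹ ^ (Fintype.card F - 1) = 1 := by rw [inv_pow, hβ, inv_one]
  obtain ⟨C, hC, hsum⟩ := h.exists_sum_eq A hα
  rw [aeval_revPoly (inv_mul_cancel₀ hβ0) hα, hsum, mul_eq_zero, mul_eq_zero,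
    or_iff_right (inv_ne_zero hβ0), or_iff_left hC]
  by_cases hα1 : β⁻¹ ^ ν = 1
  · have hβ1 : β ^ ν = 1 := by simpa using hα1
    rw [hα1, h.sum_nonres_mul_one_pow, hpar, map_zero]
    simp [hβ1]
  · have hβ1 : β ^ ν ≠ 1 := by simpa using hα1
    exact iff_of_false (h.sum_nonres_mul_pow_ne_zero hA hα hα1) hβ1

/-- In the second case the roots different from `1` are multiple, and the root `1` is simple. -/
lemma Setting.aeval_derivative_revPoly_eq_zero_iff (h : Setting p ω g r s ν)
    (hA : quadraticChar (ZMod p) A = -1) (hp : p % 8 = 7) (hν : Odd ν)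
    (hcard : Fintype.card F - 1 = 2 * (r * ν))
    (hpar : ((r * 2 ^ (s - 1) : ℕ) : ZMod 2) - nonres A = 0) {K : Type*} [Field K]
    [Algebra (ZMod 2) K] [CharP K 2] [IsAlgClosed K] {β : K} (hβ : β ^ ν = 1) :
    aeval β (derivative (revPoly (Fintype.card F - 1) (ntuSeq p ω g A))) = 0 ↔ β ≠ 1 := by
  have hβ0 : β ≠ 0 := by
    rintro rfl
    rw [zero_pow hν.pos.ne'] at hβ
    exact zero_ne_one hβ
  have hαν : β⁻¹ ^ ν = 1 := by rw [inv_pow, hβ, inv_one]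
  have hαrν : β⁻¹ ^ (r * ν) = 1 := by rw [mul_comm, pow_mul, hαν, one_pow]
  have hα : β⁻¹ ^ (Fintype.card F - 1) = 1 := by rw [hcard, mul_comm, pow_mul, hαrν, one_pow]
  obtain ⟨C, -, hsum⟩ := h.exists_sum_eq A hα
  obtain ⟨χ, hχ⟩ := exists_mulChar h.prim_ω hα
  have heven : Even (Fintype.card F - 1) := hcard ▸ even_two_mul _
  rw [aeval_derivative_revPoly heven (inv_mul_cancel₀ hβ0) hα, hsum, hαν,
    h.sum_nonres_mul_one_pow, hpar, map_zero, zero_mul, zero_add,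
    sum_mul_ntuSeq_mul_pow h.prim_g hp h.prim_ω h.odd_card hν h.map_g hA hχ hαν, hcard,
    sum_range_two_mul_cast_mul_pow (h.odd_r.mul hν) hαrν]
  by_cases hβ1 : β = 1
  · simp [hβ1]
  · simp [hβ1]

end Main

end NTU

/-! ### The two cases of the theorem -/

theorem mainTheorem1
    (p : ℕ) [Fact p.Prime] (m : ℕ) (hm : 1 < m)
    {F : Type*} [Field F] [Finite F] [Algebra (ZMod p) F]
    (hF : Module.finrank (ZMod p) F = m)
    (ω : F) (hω : IsPrimitiveRoot ω (p ^ m - 1))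
    (N ν : ℕ) (hN : N = p ^ m - 1) (hν : ν = (p ^ m - 1) / (p - 1))
    (g : ZMod p) (hg : algebraMap (ZMod p) F g = ω ^ ν)
    (r s : ℕ) (hr : r.Prime) (hr_odd : Odd r) (hp : p = 2 ^ s * r + 1)
    (h2 : orderOf (2 : ZMod r) = r - 1) (hrp : Real.sqrt (p : ℝ) + 1 ≤ (r : ℝ))
    (A : ZMod p) (e : ℕ) (he : e < N) :
    (((A = 1 ∧ s = 1) ∨ (quadraticChar (ZMod p) A = -1 ∧ 2 ≤ s)) →
      ((X ^ NTU.gcdG N e + 1 : (ZMod 2)[X]) ∣ X ^ (2 * N) + 1) ∧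
      (∀ f : (ZMod 2)[X], NTU.IsMinimalPolynomial (NTU.interleavedNTU p ω g A e) f ↔
        f = (X ^ (2 * N) + 1) / (X ^ NTU.gcdG N e + 1)) ∧
      (NTU.linearComplexity (NTU.interleavedNTU p ω g A e) : ℤ) = 2 * N - NTU.gcdG N e ∧
      (NTU.linearComplexity (NTU.interleavedNTU p ω g A e) : ℤ) =
        2 * NTU.linearComplexity (NTU.ntuSeq p ω g A) - NTU.gcdG N e) ∧
    ((quadraticChar (ZMod p) A = -1 ∧ Odd m ∧ p % 8 = 7) →
      (((X ^ (4 * ν) + 1) * (X ^ NTU.gcdH1 N e + 1) : (ZMod 2)[X]) ∣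
        (X ^ (2 * N) + 1) * (X ^ 2 + 1) * (X ^ NTU.gcdH0 ν e + 1)) ∧
      (∀ f : (ZMod 2)[X], NTU.IsMinimalPolynomial (NTU.interleavedNTU p ω g A e) f ↔
        f = ((X ^ (2 * N) + 1) * (X ^ 2 + 1) * (X ^ NTU.gcdH0 ν e + 1)) /
          ((X ^ (4 * ν) + 1) * (X ^ NTU.gcdH1 N e + 1))) ∧
      (NTU.linearComplexity (NTU.interleavedNTU p ω g A e) : ℤ) =
        2 * N + 2 - 4 * ν + NTU.gcdH0 ν e - NTU.gcdH1 N e ∧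
      (NTU.linearComplexity (NTU.interleavedNTU p ω g A e) : ℤ) =
        2 * NTU.linearComplexity (NTU.ntuSeq p ω g A) + NTU.gcdH0 ν e - NTU.gcdH1 N e) := by
  have := Fintype.ofFinite F
  have hprime : p.Prime := Fact.out
  have hcard : Fintype.card F = p ^ m := by
    rw [Module.card_eq_pow_finrank (K := ZMod p), ZMod.card, hF]
  have hs : 0 < s := by
    rcases Nat.eq_zero_or_pos s with rfl | hs
    · exfalso
      rw [pow_zero, one_mul] at hp
      have h3 : Even p := hp ▸ hr_odd.add_one
      rw [hprime.even_iff] at h3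
      have := hr.two_le
      omega
    · exact hs
  have hp_odd : Odd p := by
    rw [hp]
    exact ((Nat.even_pow.2 ⟨even_two, hs.ne'⟩).mul_right r).add_one
  have hpm1 : 0 < p ^ m - 1 := by
    have := Nat.one_lt_pow (by omega : m ≠ 0) hprime.one_lt
    omega
  have hNν : p ^ m - 1 = ν * (p - 1) := by
    rw [hν, Nat.div_mul_cancel]
    simpa using Nat.sub_dvd_pow_sub_pow p 1 m
  have hS : NTU.Setting p ω g r s ν :=
    { odd_p := hp_odd
      odd_card := hcard ▸ hp_odd.pow
      prim_ω := by rwa [hcard]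
      prim_g := by
        refine IsPrimitiveRoot.of_map_of_injective (f := algebraMap (ZMod p) F) ?_
          (algebraMap (ZMod p) F).injective
        rw [hg]
        exact hω.pow hpm1 hNν
      map_g := hg
      card_sub_one := by rw [hcard, hNν]
      prime_r := hr
      odd_r := hr_odd
      s_pos := hs
      p_eq := by rw [hp, mul_comm]
      orderOf_two := h2
      p_lt := by
        have h3 : Real.sqrt p < r := by linarith
        rw [Real.sqrt_lt' (by exact_mod_cast hr.pos)] at h3
        exact_mod_cast h3 }
  have hcharK : CharP (AlgebraicClosure (ZMod 2)) 2 :=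
    charP_of_injective_algebraMap (algebraMap (ZMod 2) (AlgebraicClosure (ZMod 2))).injective 2
  have hNcard : Fintype.card F - 1 = N := by rw [hcard, hN]
  have hN0 : 0 < N := hN ▸ hpm1
  have hper : Function.Periodic (NTU.ntuSeq p ω g A) N := by
    rw [← hNcard]
    exact NTU.ntuSeq_periodic hS.prim_ω
  have hnonres : quadraticChar (ZMod p) A = -1 → NTU.nonres A = 1 ∧ A ≠ 0 := by
    refine fun hA => ⟨NTU.nonres_eq_one_iff.2 (quadraticChar_neg_one_iff_not_isSquare.1 hA), ?_⟩
    rintro rfl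
    simp at hA
  have hr1 : ((r : ℕ) : ZMod 2) = 1 := (ZMod.natCast_eq_one_iff_odd).2 hr_odd
  constructor
  · intro hcase
    -- Here r 2^(s-1) = (p - 1)/2. It is odd with A a square, or even with A a nonresidue.
    have hA : A ≠ 0 ∧ ((r * 2 ^ (s - 1) : ℕ) : ZMod 2) - NTU.nonres A ≠ 0 := by
      rcases hcase with ⟨rfl, rfl⟩ | ⟨hA, hs2⟩
      · refine ⟨one_ne_zero, ?_⟩
        simp [NTU.nonres, hr1]
      · refine ⟨(hnonres hA).2, ?_⟩
        rw [(hnonres hA).1, Nat.cast_mul, Nat.cast_pow]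
        have h0 : ((2 : ℕ) : ZMod 2) ^ (s - 1) = 0 := by
          rw [show ((2 : ℕ) : ZMod 2) = 0 by rfl, zero_pow (by omega)]
        rw [h0, mul_zero]
        decide
    obtain ⟨h, hh⟩ : ∃ h, N = 2 * h := by
      have : Even (p ^ m - 1) := Nat.Odd.sub_odd hp_odd.pow odd_one
      rw [← hN] at this
      exact even_iff_two_dvd.1 this
    subst hh
    have hh0 : 0 < h := by omega
    obtain ⟨hT, Q, hQ, hL, hmin⟩ := NTU.minimalPolynomial_interleave_of_coprime
      (AlgebraicClosure (ZMod 2)) hh0 hper (fun β hβ => by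
        have := hS.aeval_revPoly_ne_zero hA.1 hA.2 (β := β) (by rwa [hNcard])
        rwa [hNcard] at this) e
    have hG : NTU.gcdG (2 * h) e = (NTU.oddShift e).gcd h := NTU.gcdG_eq hh0 e
    rw [← hG] at hQ
    have hGpos : 0 < NTU.gcdG (2 * h) e := by
      rw [hG]
      exact Nat.gcd_pos_of_pos_right _ hh0
    have hGm := NTU.X_pow_sub_one_monic hGpos
    have hQ0 : Q ≠ 0 := by
      rintro rfl
      rw [mul_zero] at hQ
      exact (NTU.X_pow_sub_one_monic (n := 2 * (2 * h)) (by omega)).ne_zero hQ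
    have hdeg := congr_arg natDegree hQ
    rw [natDegree_mul hGm.ne_zero hQ0, NTU.X_pow_sub_one_natDegree,
      NTU.X_pow_sub_one_natDegree] at hdeg
    have hL' : NTU.linearComplexity (NTU.interleavedNTU p ω g A e) = Q.natDegree := hL
    rw [NTU.X_pow_add_one_eq, NTU.X_pow_add_one_eq, hQ, mul_div_cancel_left₀ _ hGm.ne_zero, hL', hT]
    refine ⟨dvd_mul_right _ _, hmin, ?_, ?_⟩ <;> · push_cast; omega
  · rintro ⟨hA, hm_odd, hp8⟩
    -- If s ≥ 2, then p ≡ 1 modulo 4.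
    have hs1 : s = 1 := by
      by_contra hs1
      obtain ⟨t, rfl⟩ : ∃ t, s = t + 2 := ⟨s - 2, by omega⟩
      have : p = 4 * (2 ^ t * r) + 1 := by rw [hp]; ring
      omega
    subst hs1
    -- ν = 1 + p + ⋯ + p^(m-1) is a sum of m odd terms, with m odd.
    have hν_odd : Odd ν := by
      rw [hν, ← Nat.geomSum_eq hprime.two_le, ← ZMod.natCast_eq_one_iff_odd, Nat.cast_sum]
      simp [(ZMod.natCast_eq_one_iff_odd).2 hp_odd, (ZMod.natCast_eq_one_iff_odd).2 hm_odd]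
    have hNr : N = 2 * (r * ν) := by
      rw [hN, hNν, hp, Nat.add_sub_cancel]
      ring
    have hpar : ((r * 2 ^ (1 - 1) : ℕ) : ZMod 2) - NTU.nonres A = 0 := by
      simp [(hnonres hA).1, hr1]
    have hcard2 : Fintype.card F - 1 = 2 * (r * ν) := by rw [hNcard, hNr]
    obtain ⟨hT, Q, hQ, hL, hmin⟩ := NTU.minimalPolynomial_interleave_of_defect
      (AlgebraicClosure (ZMod 2)) hr_odd hν_odd (hNr ▸ hper) (fun β hβ => by
        have := hS.aeval_revPoly_eq_zero_iff (hnonres hA).2 hpar (β := β)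
          (by rw [hcard2, mul_comm, pow_mul, hβ, one_pow])
        rwa [hcard2] at this) (fun β hβ => by
        have := hS.aeval_derivative_revPoly_eq_zero_iff hA hp8 hν_odd hcard2 hpar hβ
        rwa [hcard2] at this) e
    subst hNr
    have hrν : Odd (r * ν) := hr_odd.mul hν_odd
    rw [← NTU.gcdH0_eq hν_odd.pos, ← NTU.gcdH1_eq hrν.pos] at hQ
    have hH0pos : 0 < NTU.gcdH0 ν e := by
      rw [NTU.gcdH0_eq hν_odd.pos]
      exact Nat.gcd_pos_of_pos_right _ hν_odd.pos
    have hH1pos : 0 < NTU.gcdH1 (2 * (r * ν)) e := by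
      rw [NTU.gcdH1_eq hrν.pos]
      exact Nat.gcd_pos_of_pos_right _ hrν.pos
    have hm1 := NTU.X_pow_sub_one_monic (n := 2 * (2 * (r * ν))) (by omega)
    have hm2 := NTU.X_pow_sub_one_monic (n := 2) two_pos
    have hm3 := NTU.X_pow_sub_one_monic hH0pos
    have hm4 := NTU.X_pow_sub_one_monic (n := 4 * ν) (by have := hν_odd.pos; omega)
    have hm5 := NTU.X_pow_sub_one_monic hH1pos
    have hQ0 : Q ≠ 0 := by
      rintro rfl
      rw [mul_zero] at hQ
      exact ((hm1.mul hm2).mul hm3).ne_zero hQ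
    have hdeg := congr_arg natDegree hQ
    rw [natDegree_mul (hm4.mul hm5).ne_zero hQ0, hm4.natDegree_mul hm5,
      (hm1.mul hm2).natDegree_mul hm3, hm1.natDegree_mul hm2] at hdeg
    simp only [NTU.X_pow_sub_one_natDegree] at hdeg
    have hL' : NTU.linearComplexity (NTU.interleavedNTU p ω g A e) = Q.natDegree := hL
    simp only [NTU.X_pow_add_one_eq]
    rw [hQ, mul_div_cancel_left₀ _ (hm4.mul hm5).ne_zero, hL']
    refine ⟨dvd_mul_right _ _, hmin, ?_, ?_⟩ <;> · push_cast at *; omega
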